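/- Let $1<p<5$. Let $f:\mathbb{R}\to\mathbb{R}$ be such that $|f(s)|\le C s^{(p-1)/2}$ for all $s\ge 0$ and some constant $C$, and such that the nonlinearity $z\mapsto f(|z|^2)z$ is locally Lipschitz on $\mathbb{C}$ (this holds in particular when $s\mapsto f(s^2)$ is locally Lipschitz, and when $f(s)=\pm s^{(p-1)/2}$). A global odd solution of $$i u_t+u_{xx}=f(|u|^2)u,\qquad (t,x)\in\mathbb{R}\times\mathbb{R},$$ is a function $u\in C(\mathbb{R};H^1(\mathbb{R}))$, complex valued, with $u(t,-x)=-u(t,x)$ for all $t$, that satisfies the equation in the sense of distributions, i.e. for all real-valued $\phi\in C_c^\infty(\mathbb{R})$ and all $t\in\mathbb{R}$, $i\frac{d}{dt}\int u\phi\,dx=\int u_x\phi'\,dx+\int f(|u|^2)u\phi\,dx$. Then there is $\varepsilon>0$ such that every global odd solution $u$ with $\|u(0)\|_{H^1(\mathbb{R})}\le\varepsilon$ satisfies $$\lim_{t\to\infty}\left(\|u(t)\|_{L^2(I)}+\|u(t)\|_{L^\infty(I)}\right)=0\qquad\text{for every bounded interval } I\subset\mathbb{R}.$$ Moreover, in the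 defocusing case $f(s)=s^{(p-1)/2}$ ($s\ge 0$), the same conclusion holds for every global odd solution $u$, without any smallness condition on $u(0)$. -/

import Mathlib

open MeasureTheory Filter Topology
open scoped ENNReal ContDiff

noncomputable section

namespace OddNLS

/-- Real test functions on the line: smooth with compact support. -/
def IsTestFunction (φ : ℝ → ℝ) : Prop :=
  ContDiff ℝ ∞ φ ∧ HasCompactSupport φ

/-- `w` is the weak (distributional) derivative of `v` on the line:
`∫ v φ' = - ∫ w φ` for all test functions `φ`. Used for locally integrable `v`, `w`. -/
def IsWeakDeriv (v w : ℝ → ℂ) : Prop :=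
  ∀ φ : ℝ → ℝ, IsTestFunction φ → ∫ x, v x * ((deriv φ x : ℝ) : ℂ) = - ∫ x, w x * (φ x : ℂ)

/-- Complex valued square integrable functions on the line, modulo equality a.e. -/
abbrev L2 : Type := Lp ℂ 2 (volume : Measure ℝ)

theorem IsTestFunction.memLp {φ : ℝ → ℝ} (h : IsTestFunction φ) :
    MemLp (fun x => (φ x : ℂ)) 2 volume :=
  (h.1.continuous.memLp_of_hasCompactSupport h.2).ofReal

theorem IsTestFunction.deriv {φ : ℝ → ℝ} (h : IsTestFunction φ) :
    IsTestFunction (deriv φ) :=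
  ⟨(contDiff_infty_iff_deriv.1 h.1).2, h.2.deriv⟩

theorem integrable_mul_test (v : L2) {φ : ℝ → ℝ} (h : IsTestFunction φ) :
    Integrable (fun x => v x * (φ x : ℂ)) volume :=
  (Lp.memLp v).integrable_mul h.memLp

/-- The Sobolev space `H¹(ℝ)` of complex valued functions, realized as the space of pairs `(v, w)`
of `L²` functions such that `w` is the weak derivative of `v` (so `w` is determined by `v`).
It carries the norm `(‖v‖² + ‖w‖²)^(1/2)` of the `ℓ²` product, which is the usual `H¹` norm. -/
def h1Submodule : Submodule ℂ (WithLp 2 (L2 × L2)) where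
  carrier := {z | IsWeakDeriv z.fst z.snd}
  zero_mem' := by
    rw [Set.mem_ofPred_eq]
    intro φ hφ
    rw [integral_congr_ae (g := fun _ => (0 : ℂ)), integral_congr_ae (g := fun _ => (0 : ℂ))]
    · simp
    · filter_upwards with x
      simp
    · filter_upwards with x
      simp
  add_mem' := by
    intro a b ha hb
    rw [Set.mem_ofPred_eq] at *
    intro φ hφ
    have e1 : ∫ x, (a + b).fst x * ((deriv φ x : ℝ) : ℂ)
        = ∫ x, (a.fst x * ((deriv φ x : ℝ) : ℂ) + b.fst x * ((deriv φ x : ℝ) : ℂ)) := by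
      refine integral_congr_ae ?_
      filter_upwards [Lp.coeFn_add a.fst b.fst] with x hx
      rw [WithLp.add_fst, hx, Pi.add_apply, add_mul]
    have e2 : ∫ x, (a + b).snd x * (φ x : ℂ)
        = ∫ x, (a.snd x * (φ x : ℂ) + b.snd x * (φ x : ℂ)) := by
      refine integral_congr_ae ?_
      filter_upwards [Lp.coeFn_add a.snd b.snd] with x hx
      rw [WithLp.add_snd, hx, Pi.add_apply, add_mul]
    rw [e1, e2, integral_add (integrable_mul_test _ hφ.deriv) (integrable_mul_test _ hφ.deriv),
      integral_add (integrable_mul_test _ hφ) (integrable_mul_test _ hφ), ha φ hφ, hb φ hφ]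
    ring
  smul_mem' := by
    intro c a ha
    rw [Set.mem_ofPred_eq] at *
    intro φ hφ
    have e1 : ∫ x, (c • a).fst x * ((deriv φ x : ℝ) : ℂ) = ∫ x, c * (a.fst x * ((deriv φ x : ℝ) : ℂ)) := by
      refine integral_congr_ae ?_
      filter_upwards [Lp.coeFn_smul c a.fst] with x hx
      simp [hx, mul_assoc]
    have e2 : ∫ x, (c • a).snd x * (φ x : ℂ) = ∫ x, c * (a.snd x * (φ x : ℂ)) := by
      refine integral_congr_ae ?_
      filter_upwards [Lp.coeFn_smul c a.snd] with x hx
      simp [hx, mul_assoc]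
    rw [e1, e2, integral_const_mul, integral_const_mul, ha φ hφ]
    ring

/-- The Hilbert space `H¹(ℝ)`, with the norm and topology inherited from the `ℓ²` product. -/
abbrev H1 : Type := h1Submodule

/-- The function underlying an element of `H¹(ℝ)`. -/
def H1.fn (v : H1) : ℝ → ℂ := (v : WithLp 2 (L2 × L2)).fst

/-- The weak derivative of an element of `H¹(ℝ)`. -/
def H1.dx (v : H1) : ℝ → ℂ := (v : WithLp 2 (L2 × L2)).snd

/-- `v(-x) = -v(x)` for almost every `x`; equivalently, for every `x` if `v` stands for its
continuous representative. -/
def H1.IsOdd (v : H1) : Prop := ∀ᵐ x : ℝ, v.fn (-x) = -v.fn x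

/-- The nonlinearity `z ↦ f(|z|²) z`. -/
def nonlin (f : ℝ → ℝ) (z : ℂ) : ℂ := (f (‖z‖ ^ 2) : ℂ) * z

/-- `u ∈ C(ℝ; H¹(ℝ))` is a global solution of `i u_t + u_xx = f(|u|²) u` in the sense of
distributions in `x`: for every test function `φ` and all times `t`,
`d/dt (i ∫ u φ) = ∫ u_x φ' + ∫ f(|u|²) u φ`. -/
structure IsGlobalSolution (f : ℝ → ℝ) (u : ℝ → H1) : Prop where
  continuous : Continuous u
  equation : ∀ φ : ℝ → ℝ, IsTestFunction φ → ∀ t : ℝ,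
    HasDerivAt (fun s => Complex.I * ∫ x, (u s).fn x * (φ x : ℂ))
      ((∫ x, (u t).dx x * ((deriv φ x : ℝ) : ℂ)) + ∫ x, nonlin f ((u t).fn x) * (φ x : ℂ)) t

/-- `‖u(t)‖_{L²(I)} + ‖u(t)‖_{L^∞(I)} → 0` as `t → ∞` for every bounded interval `I`
(open, closed or half-open). -/
def LocalDecay (u : ℝ → H1) : Prop :=
  ∀ I : Set ℝ, I.OrdConnected → Bornology.IsBounded I →
    Tendsto (fun t : ℝ => eLpNorm (u t).fn 2 (volume.restrict I)
      + eLpNorm (u t).fn ∞ (volume.restrict I)) atTop (𝓝 0)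

end OddNLS

end

/-!
The proof is a virial argument. For a solution `u` set `w = sech u` and
`Q = 2 Im ∫ tanh(x) u_x conj(u)`. Along the flow
`Q' = 4 ‖w_x‖² - 2 ‖sech w‖² + 2 ∫ sech² (f(|u|²)|u|² - 2 G(u))`, where `G(z) = ½ ∫₀^{|z|²} f`
(`IsGlobalSolution.virial`, `re_inner_dilation_eq`, `virialRate_eq`). An odd `H¹` function satisfies
`|w(x)|² ≤ |x|/2 ‖w_x‖²`, hence `‖sech w‖ ≤ ‖w_x‖` (`norm_mulOp_sech_le_of_odd`), so the quadratic
part is at least `2 ‖w_x‖²`; this is where oddness enters. The nonlinear part is nonnegative in the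
defocusing case, and in general it is at most `c ‖u‖_∞^(p-1) ‖w_x‖²` (`weightedPow_le`), which is
absorbed when `u` is small. Since `Q` is bounded, `‖sech² u‖² = ‖sech w‖²` is integrable in time; its
time derivative is bounded, so it tends to zero, and the Sobolev inequality turns this into local
decay in `L²` and `L^∞`. Mass and energy conservation keep `u` bounded in `H¹`, and small for small
data because `p < 5`.

All identities have to be derived for solutions that are merely continuous in time with values in
`H¹`. Writing `ι : H¹ → L²` for the inclusion, the equation says that `ι* ι u` is differentiable
with values in `H¹` (`IsGlobalSolution.hasDerivAt`), which differentiates `⟨L u, u⟩` for every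
symmetric bounded operator `L` of `L²` that preserves `H¹` (`IsGlobalSolution.hasDerivAt_form`). The
energy and virial identities are limits of such identities in which `∂` is replaced by difference
quotients. These converge because a weak derivative in `L²` is the same as a derivative of the
translation group (`IsWeakDeriv.hasDerivAt_trans`, `isWeakDeriv_of_hasDerivAt_trans`).
-/

noncomputable section

namespace OddNLS

open scoped InnerProductSpace BoundedContinuousFunction

/-! ### Translations and weak derivatives -/

/-- The class in `L²` of a real test function. -/
def testL2 {φ : ℝ → ℝ} (h : IsTestFunction φ) : L2 := h.memLp.toLp _

theorem inner_testL2 {φ : ℝ → ℝ} (h : IsTestFunction φ) (v : L2) :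
    ⟪testL2 h, v⟫_ℂ = ∫ x, v x * (φ x : ℂ) := by
  rw [L2.inner_def]
  refine integral_congr_ae ?_
  filter_upwards [h.memLp.coeFn_toLp] with x hx
  rw [testL2, hx, RCLike.inner_apply, Complex.conj_ofReal]

theorem eq_zero_of_inner_testL2 (v : L2)
    (hv : ∀ (φ : ℝ → ℝ) (h : IsTestFunction φ), ⟪testL2 h, v⟫_ℂ = 0) : v = 0 := by
  have hloc : LocallyIntegrable v volume := (Lp.memLp v).locallyIntegrable (by norm_num)
  have := ae_eq_zero_of_integral_contDiff_smul_eq_zero hloc (fun g hg hg' => by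
    have hg2 : IsTestFunction g := ⟨hg, hg'⟩
    rw [← hv g hg2, inner_testL2]
    refine integral_congr_ae (Eventually.of_forall fun x => ?_)
    simp [mul_comm])
  rw [Lp.eq_zero_iff_ae_eq_zero]
  exact this

theorem isWeakDeriv_iff_inner {v w : L2} :
    IsWeakDeriv v w ↔ ∀ (φ : ℝ → ℝ) (h : IsTestFunction φ),
      ⟪testL2 h.deriv, v⟫_ℂ = -⟪testL2 h, w⟫_ℂ := by
  simp only [inner_testL2]
  rfl

/-- Translation `v ↦ v(· + h)` as a linear isometry of `L²`. -/
def trans (h : ℝ) : L2 →ₗᵢ[ℂ] L2 :=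
  Lp.compMeasurePreservingₗᵢ ℂ (fun x => x + h) (measurePreserving_add_right volume h)

theorem coeFn_trans (h : ℝ) (v : L2) : trans h v =ᵐ[volume] fun x => v (x + h) :=
  Lp.coeFn_compMeasurePreserving v (measurePreserving_add_right volume h)

theorem ae_comp_add (h : ℝ) {p : ℝ → Prop} (hp : ∀ᵐ x, p x) : ∀ᵐ x, p (x + h) :=
  (measurePreserving_add_right volume h).quasiMeasurePreserving.ae hp

theorem trans_trans (h k : ℝ) (v : L2) : trans h (trans k v) = trans (h + k) v := by
  apply Lp.ext
  filter_upwards [coeFn_trans h (trans k v), coeFn_trans (h + k) v,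
    ae_comp_add h (coeFn_trans k v)] with x h1 h2 h3
  rw [h1, h2, h3, add_assoc]

theorem trans_zero (v : L2) : trans 0 v = v := by
  apply Lp.ext
  filter_upwards [coeFn_trans 0 v] with x h1
  rw [h1, add_zero]

theorem inner_trans_left (h : ℝ) (v w : L2) : ⟪trans h v, w⟫_ℂ = ⟪v, trans (-h) w⟫_ℂ := by
  have := (trans h).inner_map_map v (trans (-h) w)
  rwa [trans_trans, add_neg_cancel, trans_zero] at this

theorem continuous_trans (v : L2) : Continuous fun h => trans h v := by
  rw [continuous_iff_continuousAt]
  intro h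
  let g : ℝ → C(ℝ, ℝ) := fun h => ⟨fun x => x + h, by fun_prop⟩
  have hg : Continuous g := by
    apply ContinuousMap.continuous_of_continuous_uncurry
    change Continuous fun p : ℝ × ℝ => p.2 + p.1
    fun_prop
  exact Tendsto.compMeasurePreservingLp (f := fun _ : ℝ => v) (g := g) (g₀ := g h)
    tendsto_const_nhds hg.continuousAt
    (fun a => measurePreserving_add_right volume a) (measurePreserving_add_right volume h)
    (by norm_num)

/-- Pairing a translate with a test function is differentiable in the translation parameter. -/
theorem hasDerivAt_inner_trans {φ : ℝ → ℝ} (hφ : IsTestFunction φ) (v : L2) (h : ℝ) :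
    HasDerivAt (fun k => ⟪testL2 hφ, trans k v⟫_ℂ) (-⟪testL2 hφ.deriv, trans h v⟫_ℂ) h := by
  have key : ∀ {ψ : ℝ → ℝ} (hψ : IsTestFunction ψ) (k : ℝ),
      ⟪testL2 hψ, trans k v⟫_ℂ = ∫ t, v t * ((ψ (t - k) : ℝ) : ℂ) := by
    intro ψ hψ k
    rw [inner_testL2, ← integral_add_right_eq_self (fun t => v t * ((ψ (t - k) : ℝ) : ℂ)) k]
    refine integral_congr_ae ?_
    filter_upwards [coeFn_trans k v] with x hx
    simp [hx]
  let g : ℝ → ℂ := fun y => ((φ (-y) : ℝ) : ℂ)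
  have hgc : HasCompactSupport g := by
    have : HasCompactSupport (φ ∘ (Homeomorph.neg ℝ)) := hφ.2.comp_homeomorph (Homeomorph.neg ℝ)
    exact this.comp_left (g := fun x : ℝ => (x : ℂ)) (by simp)
  have hgd : ContDiff ℝ 1 g := by
    have : ContDiff ℝ 1 φ := hφ.1.of_le (by exact_mod_cast le_top)
    exact Complex.ofRealCLM.contDiff.comp (this.comp contDiff_neg)
  have hg' : ∀ y, deriv g y = -((deriv φ (-y) : ℝ) : ℂ) := by
    intro y
    have h1 : HasDerivAt φ (deriv φ (-y)) (-y) :=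
      ((hφ.1.differentiable (by simp)) (-y)).hasDerivAt
    have h2 := h1.scomp y (hasDerivAt_neg y)
    have h3 := h2.ofReal_comp
    rw [show g = fun y => (((φ ∘ Neg.neg) y : ℝ) : ℂ) from rfl, h3.deriv]
    simp
  have hloc : LocallyIntegrable v volume := (Lp.memLp v).locallyIntegrable (by norm_num)
  have h0 := hgc.hasDerivAt_convolution_right (ContinuousLinearMap.mul ℝ ℂ) hloc hgd h
  have e1 : (fun k => ⟪testL2 hφ, trans k v⟫_ℂ)
      = convolution (v : ℝ → ℂ) g (ContinuousLinearMap.mul ℝ ℂ) volume := by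
    funext k
    rw [key hφ, convolution_def]
    simp [g]
  have e2 : -⟪testL2 hφ.deriv, trans h v⟫_ℂ
      = convolution (v : ℝ → ℂ) (deriv g) (ContinuousLinearMap.mul ℝ ℂ) volume h := by
    rw [key hφ.deriv, convolution_def, ← integral_neg]
    simp [hg']
  rw [e1, e2]
  exact h0

/-- A weak derivative is a strong `L²` derivative of the translation group. -/
theorem IsWeakDeriv.hasDerivAt_trans {v w : L2} (hvw : IsWeakDeriv v w) (h : ℝ) :
    HasDerivAt (fun k => trans k v) (trans h w) h := by
  have hc := continuous_trans w
  have hFTC : ∀ k, trans k v = v + ∫ s in (0 : ℝ)..k, trans s w := by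
    intro k
    rw [← sub_eq_zero]
    refine eq_zero_of_inner_testL2 _ fun φ hφ => ?_
    have hd : ∀ s, HasDerivAt (fun k => ⟪testL2 hφ, trans k v⟫_ℂ) ⟪testL2 hφ, trans s w⟫_ℂ s := by
      intro s
      have h1 := hasDerivAt_inner_trans hφ v s
      have h2 : -⟪testL2 hφ.deriv, trans s v⟫_ℂ = ⟪testL2 hφ, trans s w⟫_ℂ := by
        -- move the translation onto the test function
        have h3 : IsTestFunction (fun x => φ (x - s)) := by
          refine ⟨hφ.1.comp (contDiff_id.sub contDiff_const), ?_⟩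
          simpa [sub_eq_add_neg, Function.comp_def] using
            hφ.2.comp_homeomorph (Homeomorph.addRight (-s))
        have h4 := hvw _ h3
        have h5 : ∀ x, deriv (fun x => φ (x - s)) x = deriv φ (x - s) := fun x =>
          deriv_comp_sub_const φ s x
        simp only [h5] at h4
        rw [inner_testL2, inner_testL2,
          integral_congr_ae (g := fun x => v (x + s) * ((deriv φ x : ℝ) : ℂ)),
          integral_congr_ae (f := fun x => trans s w x * (φ x : ℂ))
            (g := fun x => w (x + s) * ((φ x : ℝ) : ℂ))]
        · have e1 := integral_add_right_eq_self
            (fun x => v x * ((deriv φ (x - s) : ℝ) : ℂ)) s (μ := volume)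
          have e2 := integral_add_right_eq_self
            (fun x => w x * ((φ (x - s) : ℝ) : ℂ)) s (μ := volume)
          simp only [add_sub_cancel_right] at e1 e2
          rw [e1, e2, h4, neg_neg]
        · filter_upwards [coeFn_trans s w] with x hx
          rw [hx]
        · filter_upwards [coeFn_trans s v] with x hx
          rw [hx]
      rwa [h2] at h1
    have hci : Continuous fun s => ⟪testL2 hφ, trans s w⟫_ℂ := continuous_const.inner hc
    have h6 := intervalIntegral.integral_eq_sub_of_hasDerivAt (a := 0) (b := k)
      (fun s _ => hd s) (hci.intervalIntegrable 0 k)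
    have h7 := ContinuousLinearMap.intervalIntegral_comp_comm (innerSL ℂ (testL2 hφ))
      (hc.intervalIntegrable (μ := volume) 0 k)
    simp only [innerSL_apply_apply] at h7
    rw [inner_sub_right, inner_add_right, ← h7, h6, trans_zero]
    ring
  have h8 : HasDerivAt (fun k => v + ∫ s in (0 : ℝ)..k, trans s w) (trans h w) h :=
    (intervalIntegral.integral_hasDerivAt_right (hc.intervalIntegrable _ _)
      hc.stronglyMeasurable.stronglyMeasurableAtFilter hc.continuousAt).const_add v
  exact h8.congr_of_eventuallyEq (Eventually.of_forall hFTC)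

theorem isWeakDeriv_of_hasDerivAt_trans {v w : L2} (h : HasDerivAt (fun k => trans k v) w 0) :
    IsWeakDeriv v w := by
  rw [isWeakDeriv_iff_inner]
  intro φ hφ
  have h1 := hasDerivAt_inner_trans hφ v 0
  have h2 : HasDerivAt (fun k => ⟪testL2 hφ, trans k v⟫_ℂ) ⟪testL2 hφ, w⟫_ℂ 0 :=
    ((innerSL ℂ (testL2 hφ)).restrictScalars ℝ).hasFDerivAt.comp_hasDerivAt (0 : ℝ) h
  rw [trans_zero] at h1
  rw [← h1.unique h2, neg_neg]

theorem IsWeakDeriv.trans {v w : L2} (hvw : IsWeakDeriv v w) (h : ℝ) :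
    IsWeakDeriv (trans h v) (trans h w) := by
  apply isWeakDeriv_of_hasDerivAt_trans
  have h1 := ((OddNLS.trans h).toContinuousLinearMap.restrictScalars ℝ).hasFDerivAt.comp_hasDerivAt
    (0 : ℝ) (hvw.hasDerivAt_trans 0)
  rw [trans_zero] at h1
  refine h1.congr_of_eventuallyEq (Eventually.of_forall fun k => ?_)
  change OddNLS.trans k (OddNLS.trans h v) = OddNLS.trans h (OddNLS.trans k v)
  rw [trans_trans, trans_trans, add_comm]

/-- Integration by parts for pairs with weak derivatives in `L²`: the translation group is
unitary. -/
theorem IsWeakDeriv.inner_eq_neg {v v' w w' : L2} (hv : IsWeakDeriv v v') (hw : IsWeakDeriv w w') :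
    ⟪v, w'⟫_ℂ = -⟪v', w⟫_ℂ := by
  have h1 := (hv.hasDerivAt_trans 0).inner ℂ (hw.hasDerivAt_trans 0)
  simp only [LinearIsometry.inner_map_map] at h1
  have h2 := h1.unique (hasDerivAt_const (0 : ℝ) ⟪v, w⟫_ℂ)
  exact eq_neg_of_add_eq_zero_left h2

/-! ### The Hilbert space `H¹` and operators on it -/

/-- The inclusion `H¹ → L²`. -/
def toL2 : H1 →L[ℂ] L2 := (WithLp.fstL 2 ℂ L2 L2).comp h1Submodule.subtypeL

/-- The derivative `H¹ → L²`. -/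
def grad : H1 →L[ℂ] L2 := (WithLp.sndL 2 ℂ L2 L2).comp h1Submodule.subtypeL

theorem isWeakDeriv_grad (v : H1) : IsWeakDeriv (toL2 v) (grad v) := v.2

theorem inner_H1 (v w : H1) : ⟪v, w⟫_ℂ = ⟪toL2 v, toL2 w⟫_ℂ + ⟪grad v, grad w⟫_ℂ :=
  WithLp.prod_inner_apply (v : WithLp 2 (L2 × L2)) w

theorem norm_sq_H1 (v : H1) : ‖v‖ ^ 2 = ‖toL2 v‖ ^ 2 + ‖grad v‖ ^ 2 :=
  WithLp.prod_norm_sq_eq_of_L2 (v : WithLp 2 (L2 × L2))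

theorem norm_toL2_le (v : H1) : ‖toL2 v‖ ≤ ‖v‖ :=
  (sq_le_sq₀ (norm_nonneg _) (norm_nonneg _)).1 (by nlinarith [norm_sq_H1 v, sq_nonneg ‖grad v‖])

theorem norm_grad_le (v : H1) : ‖grad v‖ ≤ ‖v‖ :=
  (sq_le_sq₀ (norm_nonneg _) (norm_nonneg _)).1 (by nlinarith [norm_sq_H1 v, sq_nonneg ‖toL2 v‖])

theorem toL2_injective : Function.Injective toL2 := by
  rw [injective_iff_map_eq_zero]
  intro v hv
  have h := isWeakDeriv_grad v
  rw [hv] at h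
  have h1 := h.hasDerivAt_trans 0
  simp only [map_zero] at h1
  have h2 := h1.unique (hasDerivAt_const (0 : ℝ) (0 : L2))
  rw [trans_zero] at h2
  have h3 := norm_sq_H1 v
  rw [hv, h2] at h3
  simpa using h3

/-- The element of `H¹` given by a function and its weak derivative. -/
def mkH1 (v w : L2) (h : IsWeakDeriv v w) : H1 := ⟨WithLp.toLp 2 (v, w), h⟩

/-- A pair of operators whose values are a function and its weak derivative, as an operator
into `H¹`. -/
def liftH1 (A B : H1 →L[ℂ] L2) (h : ∀ v, IsWeakDeriv (A v) (B v)) : H1 →L[ℂ] H1 :=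
  (((WithLp.prodContinuousLinearEquiv 2 ℂ L2 L2).symm.toContinuousLinearMap).comp
    (A.prod B)).codRestrict h1Submodule h

/-- Translation on `H¹`. -/
def transH1 (h : ℝ) : H1 →L[ℂ] H1 :=
  liftH1 ((trans h).toContinuousLinearMap.comp toL2) ((trans h).toContinuousLinearMap.comp grad)
    fun v => (isWeakDeriv_grad v).trans h

@[simp] theorem toL2_transH1 (h : ℝ) (v : H1) : toL2 (transH1 h v) = trans h (toL2 v) := rfl
@[simp] theorem grad_transH1 (h : ℝ) (v : H1) : grad (transH1 h v) = trans h (grad v) := rfl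

theorem memLp_mul (m : ℝ →ᵇ ℝ) (v : L2) : MemLp (fun x => (m x : ℂ) * v x) 2 volume := by
  refine (Lp.memLp v).of_le_mul (c := ‖m‖) ?_ ?_
  · exact ((Complex.continuous_ofReal.comp m.continuous).aestronglyMeasurable).mul
      (Lp.aestronglyMeasurable v)
  · refine Eventually.of_forall fun x => ?_
    rw [norm_mul, Complex.norm_real]
    exact mul_le_mul_of_nonneg_right (m.norm_coe_le_norm x) (norm_nonneg _)

/-- Multiplication by a bounded continuous real function on `L²`. -/
def mulOp (m : ℝ →ᵇ ℝ) : L2 →L[ℂ] L2 :=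
  LinearMap.mkContinuous
    { toFun := fun v => (memLp_mul m v).toLp _
      map_add' := by
        intro v w
        apply Lp.ext
        filter_upwards [(memLp_mul m (v + w)).coeFn_toLp, (memLp_mul m v).coeFn_toLp,
          (memLp_mul m w).coeFn_toLp, Lp.coeFn_add v w,
          Lp.coeFn_add ((memLp_mul m v).toLp _) ((memLp_mul m w).toLp _)] with x h1 h2 h3 h4 h5
        rw [h5, Pi.add_apply, h1, h2, h3, h4, Pi.add_apply, mul_add]
      map_smul' := by
        intro c v
        apply Lp.ext
        filter_upwards [(memLp_mul m (c • v)).coeFn_toLp, (memLp_mul m v).coeFn_toLp,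
          Lp.coeFn_smul c v, Lp.coeFn_smul c ((memLp_mul m v).toLp _)] with x h1 h2 h3 h4
        rw [RingHom.id_apply, h4, Pi.smul_apply, h1, h2, h3, Pi.smul_apply, smul_eq_mul,
          smul_eq_mul]
        ring }
    ‖m‖ (by
      intro v
      refine Lp.norm_le_mul_norm_of_ae_le_mul ?_
      filter_upwards [(memLp_mul m v).coeFn_toLp] with x h1
      change ‖((memLp_mul m v).toLp _ : L2) x‖ ≤ _
      rw [h1, norm_mul, Complex.norm_real]
      exact mul_le_mul_of_nonneg_right (m.norm_coe_le_norm x) (norm_nonneg _))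

theorem coeFn_mulOp (m : ℝ →ᵇ ℝ) (v : L2) : mulOp m v =ᵐ[volume] fun x => (m x : ℂ) * v x :=
  (memLp_mul m v).coeFn_toLp

theorem norm_mulOp_le (m : ℝ →ᵇ ℝ) (v : L2) : ‖mulOp m v‖ ≤ ‖m‖ * ‖v‖ := by
  refine Lp.norm_le_mul_norm_of_ae_le_mul ?_
  filter_upwards [coeFn_mulOp m v] with x h1
  rw [h1, norm_mul, Complex.norm_real]
  exact mul_le_mul_of_nonneg_right (m.norm_coe_le_norm x) (norm_nonneg _)

theorem inner_mulOp_left (m : ℝ →ᵇ ℝ) (v w : L2) : ⟪mulOp m v, w⟫_ℂ = ⟪v, mulOp m w⟫_ℂ := by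
  rw [L2.inner_def, L2.inner_def]
  refine integral_congr_ae ?_
  filter_upwards [coeFn_mulOp m v, coeFn_mulOp m w] with x h1 h2
  rw [h1, h2, RCLike.inner_apply, RCLike.inner_apply, map_mul, Complex.conj_ofReal]
  ring

theorem mulOp_mulOp (m n : ℝ →ᵇ ℝ) (v : L2) : mulOp m (mulOp n v) = mulOp (m * n) v := by
  apply Lp.ext
  filter_upwards [coeFn_mulOp m (mulOp n v), coeFn_mulOp n v, coeFn_mulOp (m * n) v] with x h1 h2 h3
  rw [h1, h2, h3]
  simp [mul_assoc]

/-- Leibniz rule for multiplication by a smooth function that is bounded with its derivative. -/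
theorem IsWeakDeriv.mul {m m' : ℝ →ᵇ ℝ} (hm : ContDiff ℝ ∞ m) (hm' : ∀ x, HasDerivAt m (m' x) x)
    {v w : L2} (h : IsWeakDeriv v w) :
    IsWeakDeriv (mulOp m v) (mulOp m w + mulOp m' v : L2) := by
  rw [isWeakDeriv_iff_inner] at h ⊢
  intro φ hφ
  have h1 : IsTestFunction (fun x => m x * φ x) := ⟨hm.mul hφ.1, hφ.2.mul_left⟩
  have h2 := h _ h1
  have e1 : mulOp m (testL2 hφ) = testL2 h1 := by
    apply Lp.ext
    filter_upwards [coeFn_mulOp m (testL2 hφ), hφ.memLp.coeFn_toLp, h1.memLp.coeFn_toLp]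
      with x a b c
    rw [a, testL2, testL2, b, c, Complex.ofReal_mul]
  have e2 : testL2 h1.deriv = mulOp m (testL2 hφ.deriv) + mulOp m' (testL2 hφ) := by
    apply Lp.ext
    filter_upwards [coeFn_mulOp m (testL2 hφ.deriv), hφ.deriv.memLp.coeFn_toLp,
      coeFn_mulOp m' (testL2 hφ), hφ.memLp.coeFn_toLp, h1.deriv.memLp.coeFn_toLp,
      Lp.coeFn_add (mulOp m (testL2 hφ.deriv)) (mulOp m' (testL2 hφ))]
      with x a b c d e f
    have hd : HasDerivAt φ (deriv φ x) x := ((hφ.1.differentiable (by simp)) x).hasDerivAt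
    have := ((hm' x).mul hd).deriv
    change deriv (fun x => m x * φ x) x = _ at this
    rw [f, Pi.add_apply, a, c, testL2, testL2, testL2, b, d, e, this]
    push_cast
    ring
  rw [e2, inner_add_left, inner_mulOp_left, inner_mulOp_left, ← e1] at h2
  rw [inner_mulOp_left] at h2
  rw [inner_add_right]
  linear_combination h2

/-- Multiplication on `H¹` by a smooth function that is bounded with its derivative. -/
def mulH1 (m m' : ℝ →ᵇ ℝ) (hm : ContDiff ℝ ∞ m) (hm' : ∀ x, HasDerivAt m (m' x) x) :
    H1 →L[ℂ] H1 :=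
  liftH1 ((mulOp m).comp toL2) ((mulOp m).comp grad + (mulOp m').comp toL2)
    fun v => (isWeakDeriv_grad v).mul hm hm'

@[simp] theorem toL2_mulH1 (m m' : ℝ →ᵇ ℝ) (hm hm') (v : H1) :
    toL2 (mulH1 m m' hm hm' v) = mulOp m (toL2 v) := rfl
@[simp] theorem grad_mulH1 (m m' : ℝ →ᵇ ℝ) (hm hm') (v : H1) :
    grad (mulH1 m m' hm hm' v) = mulOp m (grad v) + mulOp m' (toL2 v) := rfl

instance : CompleteSpace H1 := by
  have : IsClosed (h1Submodule : Set (WithLp 2 (L2 × L2))) := by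
    have h : (h1Submodule : Set (WithLp 2 (L2 × L2))) =
        ⋂ (φ : ℝ → ℝ) (hφ : IsTestFunction φ),
          {z | ⟪testL2 hφ.deriv, z.fst⟫_ℂ = -⟪testL2 hφ, z.snd⟫_ℂ} := by
      ext z
      simp only [Set.mem_iInter]
      exact isWeakDeriv_iff_inner
    rw [h]
    refine isClosed_iInter fun φ => isClosed_iInter fun hφ => isClosed_eq ?_ ?_
    · exact continuous_const.inner (WithLp.fstL 2 ℂ L2 L2).continuous
    · exact (continuous_const.inner (WithLp.sndL 2 ℂ L2 L2).continuous).neg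
  exact this.completeSpace_coe

/-! ### Density of test functions and pointwise bounds -/

/-- The classes in `H¹` of complex test functions. -/
def testSubmodule : Submodule ℂ H1 where
  carrier := {z | ∃ φ : ℝ → ℂ, ContDiff ℝ ∞ φ ∧ HasCompactSupport φ ∧
    toL2 z =ᵐ[volume] φ ∧ grad z =ᵐ[volume] deriv φ}
  zero_mem' := by
    refine ⟨0, contDiff_const, HasCompactSupport.zero, ?_, ?_⟩
    · rw [map_zero]; exact Lp.coeFn_zero _ _ _
    · rw [map_zero]
      filter_upwards [Lp.coeFn_zero ℂ 2 (volume : Measure ℝ)] with x hx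
      rw [hx]; simp
  add_mem' := by
    rintro a b ⟨φ, h1, h2, h3, h4⟩ ⟨ψ, k1, k2, k3, k4⟩
    refine ⟨φ + ψ, h1.add k1, h2.add k2, ?_, ?_⟩
    · rw [map_add]; exact (Lp.coeFn_add _ _).trans (h3.add k3)
    · rw [map_add]
      filter_upwards [Lp.coeFn_add (grad a) (grad b), h4, k4] with x e1 e2 e3
      rw [e1, Pi.add_apply, e2, e3, deriv_add ((h1.differentiable (by simp)) x)
        ((k1.differentiable (by simp)) x)]
  smul_mem' := by
    rintro c a ⟨φ, h1, h2, h3, h4⟩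
    refine ⟨c • φ, contDiff_const.smul h1, h2.smul_left (f := fun _ => c), ?_, ?_⟩
    · rw [map_smul]; exact (Lp.coeFn_smul _ _).trans (h3.const_smul c)
    · rw [map_smul]
      filter_upwards [Lp.coeFn_smul c (grad a), h4] with x e1 e2
      rw [e1, Pi.smul_apply, e2, deriv_const_smul c ((h1.differentiable (by simp)) x)]

theorem IsTestFunction.isWeakDeriv {φ : ℝ → ℝ} (h : IsTestFunction φ) :
    IsWeakDeriv (testL2 h) (testL2 h.deriv) := by
  intro ψ hψ
  have e1 : ∫ x, testL2 h x * ((_root_.deriv ψ x : ℝ) : ℂ) = ((∫ x, φ x * _root_.deriv ψ x : ℝ) : ℂ) := by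
    rw [← integral_complex_ofReal]
    refine integral_congr_ae ?_
    filter_upwards [h.memLp.coeFn_toLp] with x hx
    rw [testL2, hx, Complex.ofReal_mul]
  have e2 : ∫ x, testL2 h.deriv x * ((ψ x : ℝ) : ℂ) = ((∫ x, _root_.deriv φ x * ψ x : ℝ) : ℂ) := by
    rw [← integral_complex_ofReal]
    refine integral_congr_ae ?_
    filter_upwards [h.deriv.memLp.coeFn_toLp] with x hx
    rw [testL2, hx, Complex.ofReal_mul]
  rw [e1, e2, ← Complex.ofReal_neg]
  congr 1
  refine integral_mul_deriv_eq_deriv_mul_of_integrable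
    (fun x _ => ((h.1.differentiable (by simp)) x).hasDerivAt)
    (fun x _ => ((hψ.1.differentiable (by simp)) x).hasDerivAt) ?_ ?_ ?_
  · exact (h.1.continuous.mul hψ.deriv.1.continuous).integrable_of_hasCompactSupport
      h.2.mul_right
  · exact (h.deriv.1.continuous.mul hψ.1.continuous).integrable_of_hasCompactSupport
      hψ.2.mul_left
  · exact (h.1.continuous.mul hψ.1.continuous).integrable_of_hasCompactSupport
      h.2.mul_right

/-- The class in `H¹` of a real test function. -/
def testH1 {φ : ℝ → ℝ} (h : IsTestFunction φ) : H1 := mkH1 _ _ h.isWeakDeriv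

theorem testH1_mem {φ : ℝ → ℝ} (h : IsTestFunction φ) : testH1 h ∈ testSubmodule := by
  refine ⟨fun x => (φ x : ℂ), Complex.ofRealCLM.contDiff.comp h.1,
    h.2.comp_left (g := fun x : ℝ => (x : ℂ)) (by simp), h.memLp.coeFn_toLp, ?_⟩
  filter_upwards [h.deriv.memLp.coeFn_toLp] with x hx
  have hd : HasDerivAt φ (deriv φ x) x := ((h.1.differentiable (by simp)) x).hasDerivAt
  rw [hd.ofReal_comp.deriv, ← hx]
  rfl

/-- If `z = (v, v')` is orthogonal to the test functions then `v'' = v`, and integration by parts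
gives `‖v‖² = -‖v'‖²`. -/
theorem eq_zero_of_inner_testH1 (z : H1)
    (hz : ∀ (φ : ℝ → ℝ) (h : IsTestFunction φ), ⟪testH1 h, z⟫_ℂ = 0) : z = 0 := by
  have h1 : IsWeakDeriv (grad z) (toL2 z) := by
    rw [isWeakDeriv_iff_inner]
    intro φ hφ
    have := hz φ hφ
    rw [inner_H1] at this
    exact eq_neg_of_add_eq_zero_right this
  have h2 := (isWeakDeriv_grad z).inner_eq_neg h1
  rw [inner_self_eq_norm_sq_to_K, inner_self_eq_norm_sq_to_K] at h2
  have h3 : ‖toL2 z‖ ^ 2 = -‖grad z‖ ^ 2 := by exact_mod_cast h2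
  have h4 : ‖z‖ ^ 2 = 0 := by rw [norm_sq_H1, h3]; ring
  simpa using h4

theorem dense_testSubmodule : Dense (testSubmodule : Set H1) := by
  rw [Submodule.dense_iff_topologicalClosure_eq_top, Submodule.topologicalClosure_eq_top_iff,
    Submodule.eq_bot_iff]
  intro z hz
  exact eq_zero_of_inner_testH1 z fun φ h => Submodule.inner_right_of_mem_orthogonal (testH1_mem h) hz

theorem exists_test_approx (v : H1) : ∃ (φ : ℕ → ℝ → ℂ) (z : ℕ → H1),
    (∀ n, ContDiff ℝ ∞ (φ n)) ∧ (∀ n, HasCompactSupport (φ n)) ∧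
    (∀ n, toL2 (z n) =ᵐ[volume] φ n) ∧ (∀ n, grad (z n) =ᵐ[volume] deriv (φ n)) ∧
    Tendsto z atTop (𝓝 v) ∧ ∀ᵐ x, Tendsto (fun n => φ n x) atTop (𝓝 (toL2 v x)) := by
  obtain ⟨z, hz, hzv⟩ := mem_closure_iff_seq_limit.1 (dense_testSubmodule v)
  choose φ h1 h2 h3 h4 using hz
  have hL : Tendsto (fun n => toL2 (z n)) atTop (𝓝 (toL2 v)) :=
    (toL2.continuous.tendsto v).comp hzv
  obtain ⟨ns, hns, hae⟩ := (tendstoInMeasure_of_tendsto_Lp hL).exists_seq_tendsto_ae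
  refine ⟨fun n => φ (ns n), fun n => z (ns n), fun n => h1 _, fun n => h2 _, fun n => h3 _,
    fun n => h4 _, hzv.comp hns.tendsto_atTop, ?_⟩
  have : ∀ᵐ x, ∀ n, toL2 (z n) x = φ n x := ae_all_iff.2 h3
  filter_upwards [hae, this] with x a b
  simpa [b] using a

theorem integral_norm_mul_norm_le (f g : L2) : ∫ x, ‖f x‖ * ‖g x‖ ≤ ‖f‖ * ‖g‖ := by
  have hf := (Lp.memLp f).norm
  have hg := (Lp.memLp g).norm
  have h1 : ∫ x, ‖f x‖ * ‖g x‖ = ⟪hf.toLp _, hg.toLp _⟫_ℝ := by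
    rw [L2.inner_def]
    refine integral_congr_ae ?_
    filter_upwards [hf.coeFn_toLp, hg.coeFn_toLp] with x a b
    rw [a, b, RCLike.inner_apply]
    simp [mul_comm]
  rw [h1]
  refine (real_inner_le_norm _ _).trans (le_of_eq ?_)
  rw [Lp.norm_toLp, Lp.norm_toLp, eLpNorm_norm, eLpNorm_norm]
  rfl

theorem integrable_norm_mul_norm (f g : L2) : Integrable (fun x => ‖f x‖ * ‖g x‖) :=
  (Lp.memLp f).norm.integrable_mul (Lp.memLp g).norm

/-- `‖v‖_∞² ≤ 2 ‖v‖ ‖v'‖`. -/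
theorem norm_sq_le_of_H1 (v : H1) : ∀ᵐ x, ‖toL2 v x‖ ^ 2 ≤ 2 * (‖toL2 v‖ * ‖grad v‖) := by
  obtain ⟨φ, z, h1, h2, h3, h4, hz, hae⟩ := exists_test_approx v
  have key : ∀ n x, ‖φ n x‖ ^ 2 ≤ 2 * (‖toL2 (z n)‖ * ‖grad (z n)‖) := by
    intro n x
    have hd : ∀ y, HasDerivAt (φ n) (deriv (φ n) y) y := fun y =>
      (((h1 n).differentiable (by simp)) y).hasDerivAt
    have hd2 : ∀ y, HasDerivAt (fun y => ‖φ n y‖ ^ 2) (2 * ⟪φ n y, deriv (φ n) y⟫_ℝ) y :=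
      fun y => (hd y).norm_sq
    have hint : Integrable (fun y => ‖φ n y‖ * ‖deriv (φ n) y‖) := by
      refine (integrable_norm_mul_norm (toL2 (z n)) (grad (z n))).congr ?_
      filter_upwards [h3 n, h4 n] with y a b
      rw [a, b]
    have hcd : Continuous (deriv (φ n)) := (h1 n).continuous_deriv (by simp)
    have hint2 : Integrable (fun y => 2 * ⟪φ n y, deriv (φ n) y⟫_ℝ) := by
      refine (hint.const_mul 2).mono' ?_ ?_
      · exact (continuous_const.mul ((h1 n).continuous.inner hcd)).aestronglyMeasurable
      · refine Eventually.of_forall fun y => ?_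
        rw [norm_mul, Real.norm_of_nonneg (by norm_num : (0 : ℝ) ≤ 2)]
        exact mul_le_mul_of_nonneg_left (norm_inner_le_norm _ _) (by norm_num)
    have hbot : Tendsto (fun y => ‖φ n y‖ ^ 2) atBot (𝓝 0) := by
      have h5 : HasCompactSupport (fun y => ‖φ n y‖ ^ 2) :=
        (h2 n).comp_left (g := fun z : ℂ => ‖z‖ ^ 2) (by simp)
      have h6 := h5.is_zero_at_infty
      exact h6.mono_left (by
        rw [cocompact_eq_atBot_atTop]; exact le_sup_left)
    have h7 := integral_Iic_of_hasDerivAt_of_tendsto (a := x)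
      ((hd2 x).continuousAt.continuousWithinAt) (fun y _ => hd2 y) hint2.integrableOn hbot
    rw [sub_zero] at h7
    rw [← h7]
    calc ∫ y in Set.Iic x, 2 * ⟪φ n y, deriv (φ n) y⟫_ℝ
        ≤ ∫ y in Set.Iic x, 2 * (‖φ n y‖ * ‖deriv (φ n) y‖) := by
          refine setIntegral_mono hint2.integrableOn (hint.const_mul 2).integrableOn fun y => ?_
          exact mul_le_mul_of_nonneg_left (real_inner_le_norm _ _) (by norm_num)
      _ ≤ ∫ y, 2 * (‖φ n y‖ * ‖deriv (φ n) y‖) :=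
          setIntegral_le_integral (hint.const_mul 2) (Eventually.of_forall fun y => by positivity)
      _ = 2 * ∫ y, ‖toL2 (z n) y‖ * ‖grad (z n) y‖ := by
          rw [integral_const_mul]
          congr 1
          refine integral_congr_ae ?_
          filter_upwards [h3 n, h4 n] with y a b
          rw [a, b]
      _ ≤ _ := mul_le_mul_of_nonneg_left (integral_norm_mul_norm_le _ _) (by norm_num)
  have hlim : Tendsto (fun n => 2 * (‖toL2 (z n)‖ * ‖grad (z n)‖)) atTop
      (𝓝 (2 * (‖toL2 v‖ * ‖grad v‖))) :=
    ((((toL2.continuous.tendsto v).comp hz).norm).mul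
      (((grad.continuous.tendsto v).comp hz).norm)).const_mul 2
  filter_upwards [hae] with x hx
  exact le_of_tendsto_of_tendsto' (hx.norm.pow 2) hlim fun n => key n x

theorem norm_le_of_H1 (v : H1) : ∀ᵐ x, ‖toL2 v x‖ ≤ ‖v‖ := by
  filter_upwards [norm_sq_le_of_H1 v] with x hx
  refine (sq_le_sq₀ (norm_nonneg _) (norm_nonneg _)).1 (hx.trans ?_)
  rw [norm_sq_H1]
  nlinarith [sq_nonneg (‖toL2 v‖ - ‖grad v‖)]

/-- An odd `H¹` function vanishes at the origin like `|x|^(1/2)`. -/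
theorem norm_sq_le_of_odd (v : H1) (hv : v.IsOdd) :
    ∀ᵐ x, ‖toL2 v x‖ ^ 2 ≤ |x| / 2 * ‖grad v‖ ^ 2 := by
  obtain ⟨φ, z, h1, h2, h3, h4, hz, hae⟩ := exists_test_approx v
  have key : ∀ n x, ‖φ n |x| - φ n (-|x|)‖ ≤ √(2 * |x|) * ‖grad (z n)‖ := by
    intro n x
    have hd : ∀ y, HasDerivAt (φ n) (deriv (φ n) y) y := fun y =>
      (((h1 n).differentiable (by simp)) y).hasDerivAt
    have hcd : Continuous (deriv (φ n)) := (h1 n).continuous_deriv (by simp)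
    have h5 := intervalIntegral.integral_eq_sub_of_hasDerivAt (a := -|x|) (b := |x|)
      (fun y _ => hd y) (hcd.intervalIntegrable _ _)
    have hle : -|x| ≤ |x| := by linarith [abs_nonneg x]
    have hfin : (volume (Set.Ioc (-|x|) |x|)) ≠ ⊤ := measure_Ioc_lt_top.ne
    have h6 : ∫ y in Set.Ioc (-|x|) |x|, deriv (φ n) y
        = ⟪indicatorConstLp 2 measurableSet_Ioc hfin (1 : ℂ), grad (z n)⟫_ℂ := by
      rw [L2.inner_indicatorConstLp_one]
      refine setIntegral_congr_ae measurableSet_Ioc ?_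
      filter_upwards [h4 n] with y a _
      rw [a]
    rw [← h5, intervalIntegral.integral_of_le hle, h6]
    refine (norm_inner_le_norm _ _).trans (le_of_eq ?_)
    rw [norm_indicatorConstLp (by norm_num) (by norm_num)]
    congr 1
    rw [Real.sqrt_eq_rpow, Measure.real, Real.volume_Ioc, ENNReal.toReal_ofReal (by linarith)]
    norm_num
    congr 1
    ring
  have hlim : ∀ x : ℝ, Tendsto (fun n => √(2 * |x|) * ‖grad (z n)‖) atTop
      (𝓝 (√(2 * |x|) * ‖grad v‖)) := fun x =>
    (((grad.continuous.tendsto v).comp hz).norm).const_mul _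
  have hneg : ∀ᵐ x, Tendsto (fun n => φ n (-x)) atTop (𝓝 (toL2 v (-x))) :=
    (Measure.measurePreserving_neg (volume : Measure ℝ)).quasiMeasurePreserving.ae hae
  filter_upwards [hae, hneg, hv] with x a b c
  have c' : toL2 v (-x) = -toL2 v x := c
  have h8 : Tendsto (fun n => ‖φ n |x| - φ n (-|x|)‖) atTop (𝓝 (2 * ‖toL2 v x‖)) := by
    rcases abs_cases x with ⟨e, _⟩ | ⟨e, _⟩
    · rw [e]
      have := (a.sub b).norm
      rwa [c', sub_neg_eq_add, ← two_mul, norm_mul, Complex.norm_two] at this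
    · rw [e, neg_neg]
      have := (b.sub a).norm
      rwa [c', ← neg_add', norm_neg, ← two_mul, norm_mul, Complex.norm_two] at this
  have h9 := le_of_tendsto_of_tendsto' h8 (hlim x) fun n => key n x
  have h10 : (2 * ‖toL2 v x‖) ^ 2 ≤ (√(2 * |x|) * ‖grad v‖) ^ 2 := by gcongr
  rw [mul_pow, mul_pow, Real.sq_sqrt (by positivity)] at h10
  nlinarith

/-! ### The nonlinearity on `H¹` -/

theorem norm_sq_eq_integral (v : L2) : ‖v‖ ^ 2 = ∫ x, ‖v x‖ ^ 2 := by
  have h : (⟪v, v⟫_ℂ) = ((∫ x, ‖v x‖ ^ 2 : ℝ) : ℂ) := by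
    rw [L2.inner_def, ← integral_complex_ofReal]
    refine integral_congr_ae (Eventually.of_forall fun x => ?_)
    simp [inner_self_eq_norm_sq_to_K]
  rw [inner_self_eq_norm_sq_to_K] at h
  exact Complex.ofReal_injective (by rw [Complex.ofReal_pow]; exact h)

theorem integrable_norm_sq (v : L2) : Integrable fun x => ‖v x‖ ^ 2 :=
  (Lp.memLp v).integrable_norm_pow (by norm_num)

theorem re_inner_eq_integral (v w : L2) : (⟪v, w⟫_ℂ).re = ∫ x, ⟪v x, w x⟫_ℝ := by
  rw [L2.inner_def]
  exact (integral_re (𝕜 := ℂ) (L2.integrable_inner (𝕜 := ℂ) v w)).symm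

theorem integrable_real_inner (v w : L2) : Integrable fun x => ⟪v x, w x⟫_ℝ :=
  (L2.integrable_inner (𝕜 := ℂ) v w).re

theorem nonlin_zero (f : ℝ → ℝ) : nonlin f 0 = 0 := by simp [nonlin]

theorem exists_lipschitz_nonlin {f : ℝ → ℝ} (hL : LocallyLipschitz (nonlin f)) (R : ℝ) :
    ∃ K : ℝ, 0 ≤ K ∧ ∀ a b : ℂ, ‖a‖ ≤ R → ‖b‖ ≤ R →
      ‖nonlin f a - nonlin f b‖ ≤ K * ‖a - b‖ := by
  obtain ⟨K, hK⟩ := (hL.locallyLipschitzOn (s := Metric.closedBall (0 : ℂ) R)).exists_lipschitzOnWith_of_compact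
    (isCompact_closedBall 0 R)
  refine ⟨K, K.2, fun a b ha hb => ?_⟩
  exact hK.norm_sub_le (by simpa using ha) (by simpa using hb)

theorem norm_nonlin_le {f : ℝ → ℝ} {R K : ℝ} (hR : 0 ≤ R) (hK : ∀ a b : ℂ, ‖a‖ ≤ R → ‖b‖ ≤ R →
      ‖nonlin f a - nonlin f b‖ ≤ K * ‖a - b‖) {a : ℂ} (ha : ‖a‖ ≤ R) :
    ‖nonlin f a‖ ≤ K * ‖a‖ := by
  simpa [nonlin_zero] using hK a 0 ha (by simpa using hR)

theorem memLp_nonlin {f : ℝ → ℝ} (hL : LocallyLipschitz (nonlin f)) (v : H1) :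
    MemLp (fun x => nonlin f (toL2 v x)) 2 volume := by
  obtain ⟨K, -, hK⟩ := exists_lipschitz_nonlin hL ‖v‖
  refine (Lp.memLp (toL2 v)).of_le_mul (c := K)
    (hL.continuous.comp_aestronglyMeasurable (Lp.aestronglyMeasurable _)) ?_
  filter_upwards [norm_le_of_H1 v] with x hx
  exact norm_nonlin_le (norm_nonneg _) hK hx

/-- The nonlinearity as a map `H¹ → L²`. -/
def nonlinL2 {f : ℝ → ℝ} (hL : LocallyLipschitz (nonlin f)) (v : H1) : L2 :=
  (memLp_nonlin hL v).toLp _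

section

variable {f : ℝ → ℝ} (hL : LocallyLipschitz (nonlin f))

theorem coeFn_nonlinL2 (v : H1) : nonlinL2 hL v =ᵐ[volume] fun x => nonlin f (toL2 v x) :=
  (memLp_nonlin hL v).coeFn_toLp

theorem exists_lipschitz_nonlinL2 (R : ℝ) : ∃ K : ℝ, 0 ≤ K ∧ ∀ v w : H1, ‖v‖ ≤ R → ‖w‖ ≤ R →
    ‖nonlinL2 hL v - nonlinL2 hL w‖ ≤ K * ‖toL2 v - toL2 w‖ := by
  obtain ⟨K, hK0, hK⟩ := exists_lipschitz_nonlin hL R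
  refine ⟨K, hK0, fun v w hv hw => Lp.norm_le_mul_norm_of_ae_le_mul ?_⟩
  filter_upwards [coeFn_nonlinL2 hL v, coeFn_nonlinL2 hL w, norm_le_of_H1 v, norm_le_of_H1 w,
    Lp.coeFn_sub (nonlinL2 hL v) (nonlinL2 hL w), Lp.coeFn_sub (toL2 v) (toL2 w)]
    with x h1 h2 h3 h4 h5 h6
  rw [h5, h6, Pi.sub_apply, Pi.sub_apply, h1, h2]
  exact hK _ _ (h3.trans hv) (h4.trans hw)

theorem continuous_nonlinL2 : Continuous (nonlinL2 hL) := by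
  rw [continuous_iff_continuousAt]
  intro v
  obtain ⟨K, hK0, hK⟩ := exists_lipschitz_nonlinL2 hL (‖v‖ + 1)
  rw [ContinuousAt, tendsto_iff_norm_sub_tendsto_zero]
  have h1 : Tendsto (fun w => K * ‖toL2 w - toL2 v‖) (𝓝 v) (𝓝 0) := by
    have : Continuous fun w => K * ‖toL2 w - toL2 v‖ := by fun_prop
    simpa using this.tendsto v
  refine squeeze_zero' (Eventually.of_forall fun _ => norm_nonneg _) ?_ h1
  have h2 : ∀ᶠ w in 𝓝 v, ‖w‖ < ‖v‖ + 1 :=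
    (continuous_norm.tendsto v).eventually_lt_const (by linarith)
  filter_upwards [h2] with w hw
  exact hK w v hw.le (by linarith)

theorem norm_transH1 (h : ℝ) (v : H1) : ‖transH1 h v‖ = ‖v‖ := by
  rw [← sq_eq_sq₀ (norm_nonneg _) (norm_nonneg _), norm_sq_H1, norm_sq_H1]
  simp

theorem trans_nonlinL2 (h : ℝ) (v : H1) :
    trans h (nonlinL2 hL v) = nonlinL2 hL (transH1 h v) := by
  apply Lp.ext
  filter_upwards [coeFn_trans h (nonlinL2 hL v), coeFn_nonlinL2 hL (transH1 h v),
    coeFn_trans h (toL2 v), ae_comp_add h (coeFn_nonlinL2 hL v)] with x h1 h2 h3 h4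
  rw [h1, h2, h4, toL2_transH1, h3]

theorem norm_trans_sub_le (v : H1) (h : ℝ) :
    ‖trans h (toL2 v) - toL2 v‖ ≤ ‖grad v‖ * |h| := by
  have h1 := Convex.norm_image_sub_le_of_norm_hasDerivWithin_le (s := Set.univ) (x := 0) (y := h)
    (C := ‖grad v‖) (f := fun k => trans k (toL2 v)) (f' := fun k => trans k (grad v))
    (fun k _ => ((isWeakDeriv_grad v).hasDerivAt_trans k).hasDerivWithinAt)
    (fun k _ => by simp) convex_univ trivial trivial
  simpa [trans_zero] using h1

/-- An `L²` function with bounded difference quotients has a weak derivative in `L²`: take a weak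
limit of difference quotients. -/
theorem exists_isWeakDeriv_of_norm_trans_sub_le (z : L2) (K : ℝ)
    (hz : ∀ h : ℝ, ‖trans h z - z‖ ≤ K * |h|) : ∃ w : L2, IsWeakDeriv z w ∧ ‖w‖ ≤ K := by
  let t : ℕ → ℝ := fun n => 1 / ((n : ℝ) + 1)
  have ht : ∀ n, 0 < t n := fun n => Nat.one_div_pos_of_nat
  have ht0 : Tendsto t atTop (𝓝[≠] 0) :=
    tendsto_nhdsWithin_iff.2 ⟨tendsto_one_div_add_atTop_nhds_zero_nat,
      Eventually.of_forall fun n => (ht n).ne'⟩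
  let d : ℕ → L2 := fun n => (t n)⁻¹ • (trans (t n) z - z)
  have hd : ∀ n, ‖d n‖ ≤ K := by
    intro n
    rw [norm_smul, norm_inv, Real.norm_of_nonneg (ht n).le, inv_mul_le_iff₀ (ht n), mul_comm]
    simpa [abs_of_pos (ht n)] using hz (t n)
  let l : ℕ → WeakDual ℂ L2 := fun n =>
    StrongDual.toWeakDual (InnerProductSpace.toDual ℂ L2 (d n))
  have hcomp := WeakDual.isCompact_closedBall (𝕜 := ℂ) (E := L2) 0 K
  obtain ⟨w', hw', hlim⟩ := hcomp.ultrafilter_le_nhds ((hyperfilter ℕ).map l) (by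
    rw [Ultrafilter.coe_map, le_principal_iff, mem_map]
    refine univ_mem' fun n => ?_
    simpa [l] using hd n)
  let w : L2 := (InnerProductSpace.toDual ℂ L2).symm (WeakDual.toStrongDual w')
  refine ⟨w, ?_, ?_⟩
  · rw [isWeakDeriv_iff_inner]
    intro φ hφ
    have h1 : Tendsto (fun n => ⟪d n, testL2 hφ⟫_ℂ) (hyperfilter ℕ : Filter ℕ)
        (𝓝 ⟪w, testL2 hφ⟫_ℂ) := by
      have h2 := ((WeakDual.eval_continuous (𝕜 := ℂ) (testL2 hφ)).tendsto w').comp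
        (show Tendsto l (hyperfilter ℕ : Filter ℕ) (𝓝 w') from hlim)
      have h3 : ⟪w, testL2 hφ⟫_ℂ = w' (testL2 hφ) :=
        InnerProductSpace.toDual_symm_apply
      rw [h3]
      exact h2
    have h4 : Tendsto (fun n => ⟪testL2 hφ, d n⟫_ℂ) atTop (𝓝 (-⟪testL2 hφ.deriv, z⟫_ℂ)) := by
      have h5 := (hasDerivAt_inner_trans hφ z 0).tendsto_slope.comp ht0
      rw [trans_zero] at h5
      refine h5.congr fun n => ?_
      simp only [Function.comp_apply, slope_def_module, sub_zero, trans_zero, d,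
        inner_smul_right_eq_smul, inner_sub_right]
    have h6 := (h4.mono_left Nat.hyperfilter_le_atTop)
    have h7 : Tendsto (fun n => ⟪testL2 hφ, d n⟫_ℂ) (hyperfilter ℕ : Filter ℕ)
        (𝓝 ⟪testL2 hφ, w⟫_ℂ) := by
      have := (Complex.continuous_conj.tendsto _).comp h1
      simpa only [Function.comp_def, inner_conj_symm] using this
    rw [tendsto_nhds_unique h7 h6, neg_neg]
  · have : ‖WeakDual.toStrongDual w'‖ ≤ K := by simpa using hw'
    rwa [← LinearIsometryEquiv.norm_map (InnerProductSpace.toDual ℂ L2).symm] at this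

theorem exists_nonlinL2_weakDeriv (R : ℝ) : ∃ K : ℝ, 0 ≤ K ∧ ∀ v : H1, ‖v‖ ≤ R →
    ∃ w : L2, IsWeakDeriv (nonlinL2 hL v) w ∧ ‖w‖ ≤ K * ‖grad v‖ := by
  obtain ⟨K, hK0, hK⟩ := exists_lipschitz_nonlinL2 hL R
  refine ⟨K, hK0, fun v hv => exists_isWeakDeriv_of_norm_trans_sub_le _ _ fun h => ?_⟩
  rw [trans_nonlinL2, mul_assoc]
  refine (hK _ _ (by rwa [norm_transH1]) hv).trans ?_
  exact mul_le_mul_of_nonneg_left (norm_trans_sub_le v h) hK0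

/-- The nonlinearity as a map `H¹ → H¹`. -/
def nonlinH1 (v : H1) : H1 :=
  mkH1 (nonlinL2 hL v) _ ((exists_nonlinL2_weakDeriv hL ‖v‖).choose_spec.2 v le_rfl).choose_spec.1

@[simp] theorem toL2_nonlinH1 (v : H1) : toL2 (nonlinH1 hL v) = nonlinL2 hL v := rfl

theorem exists_norm_grad_nonlinH1_le (R : ℝ) : ∃ K : ℝ, 0 ≤ K ∧ ∀ v : H1, ‖v‖ ≤ R →
    ‖grad (nonlinH1 hL v)‖ ≤ K * ‖grad v‖ := by
  obtain ⟨K, hK0, hK⟩ := exists_nonlinL2_weakDeriv hL R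
  refine ⟨K, hK0, fun v hv => ?_⟩
  obtain ⟨w, hw, hwK⟩ := hK v hv
  have : nonlinH1 hL v = mkH1 _ w hw := toL2_injective rfl
  rwa [this]

/-! ### The potential energy density -/

/-- The primitive `G(z) = ½ ∫₀^{|z|²} f` of the nonlinearity. -/
def potential (f : ℝ → ℝ) (z : ℂ) : ℝ := (∫ s in (0 : ℝ)..‖z‖ ^ 2, f s) / 2

theorem potential_zero : potential f 0 = 0 := by simp [potential]

theorem hasDerivAt_potential_line (hf : ContinuousOn f (Set.Ici 0)) (a b : ℂ) (τ : ℝ) :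
    HasDerivAt (fun τ : ℝ => potential f (a + τ • b)) ⟪nonlin f (a + τ • b), b⟫_ℝ τ := by
  have hfc : Continuous fun s => f (max s 0) :=
    hf.comp_continuous (continuous_id.max continuous_const) fun s => le_max_right s 0
  have h1 : (fun τ : ℝ => potential f (a + τ • b)) =
      fun τ : ℝ => (∫ s in (0 : ℝ)..‖a + τ • b‖ ^ 2, f (max s 0)) / 2 := by
    funext τ
    rw [potential]
    congr 1
    refine intervalIntegral.integral_congr fun s hs => ?_
    rw [Set.uIcc_of_le (by positivity)] at hs
    simp only [max_eq_left hs.1]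
  rw [h1]
  have h2 : HasDerivAt (fun τ : ℝ => a + τ • b) b τ := by
    simpa using ((hasDerivAt_id τ).smul_const b).const_add a
  have h3 := h2.norm_sq
  have h4 : HasDerivAt (fun y => ∫ s in (0 : ℝ)..y, f (max s 0)) (f (max (‖a + τ • b‖ ^ 2) 0))
      (‖a + τ • b‖ ^ 2) :=
    intervalIntegral.integral_hasDerivAt_right (hfc.intervalIntegrable _ _)
      hfc.stronglyMeasurable.stronglyMeasurableAtFilter hfc.continuousAt
  have h5 := (h4.comp τ h3).div_const 2
  refine h5.congr_deriv ?_
  rw [max_eq_left (by positivity), nonlin]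
  have : ((f (‖a + τ • b‖ ^ 2) : ℝ) : ℂ) * (a + τ • b) = f (‖a + τ • b‖ ^ 2) • (a + τ • b) :=
    Complex.real_smul.symm
  rw [this, real_inner_smul_left]
  ring

theorem abs_potential_sub_le (hf : ContinuousOn f (Set.Ici 0)) {R K : ℝ} (hK0 : 0 ≤ K)
    (hK : ∀ a b : ℂ, ‖a‖ ≤ R → ‖b‖ ≤ R → ‖nonlin f a - nonlin f b‖ ≤ K * ‖a - b‖)
    {a b : ℂ} (ha : ‖a‖ ≤ R) (hb : ‖b‖ ≤ R) :
    |potential f b - potential f a - ⟪nonlin f a, b - a⟫_ℝ| ≤ K * ‖b - a‖ ^ 2 := by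
  have hd : ∀ τ : ℝ, HasDerivAt
      (fun τ : ℝ => potential f (a + τ • (b - a)) - τ * ⟪nonlin f a, b - a⟫_ℝ)
      (⟪nonlin f (a + τ • (b - a)), b - a⟫_ℝ - ⟪nonlin f a, b - a⟫_ℝ) τ := by
    intro τ
    exact ((hasDerivAt_potential_line hf a (b - a) τ).sub
      ((hasDerivAt_id τ).mul_const ⟪nonlin f a, b - a⟫_ℝ)).congr_deriv (by rw [one_mul])
  have h1 := Convex.norm_image_sub_le_of_norm_hasDerivWithin_le (s := Set.Icc (0 : ℝ) 1)
    (x := 0) (y := 1) (C := K * ‖b - a‖ ^ 2) (fun τ _ => (hd τ).hasDerivWithinAt)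
    (fun τ hτ => ?_) (convex_Icc 0 1) (by simp) (by simp)
  · have e : (potential f (a + (1 : ℝ) • (b - a)) - 1 * ⟪nonlin f a, b - a⟫_ℝ -
        (potential f (a + (0 : ℝ) • (b - a)) - 0 * ⟪nonlin f a, b - a⟫_ℝ)) =
        potential f b - potential f a - ⟪nonlin f a, b - a⟫_ℝ := by
      rw [one_smul, zero_smul, add_zero, add_sub_cancel]; ring
    rw [e] at h1
    simpa using h1
  · rw [← inner_sub_left]
    refine (norm_inner_le_norm _ _).trans ?_
    have hc : ‖a + τ • (b - a)‖ ≤ R := by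
      have : a + τ • (b - a) ∈ Metric.closedBall (0 : ℂ) R :=
        (convex_closedBall (0 : ℂ) R).add_smul_sub_mem (by simpa using ha) (by simpa using hb) hτ
      simpa using this
    have h2 := hK _ _ hc ha
    rw [add_sub_cancel_left, norm_smul, Real.norm_of_nonneg hτ.1] at h2
    have h3 : τ * ‖b - a‖ ≤ ‖b - a‖ := mul_le_of_le_one_left (norm_nonneg _) hτ.2
    calc _ ≤ (K * (τ * ‖b - a‖)) * ‖b - a‖ := by gcongr
      _ ≤ (K * ‖b - a‖) * ‖b - a‖ := by gcongr
      _ = _ := by ring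

theorem abs_potential_le (hf : ContinuousOn f (Set.Ici 0)) {R K : ℝ} (hR : 0 ≤ R) (hK0 : 0 ≤ K)
    (hK : ∀ a b : ℂ, ‖a‖ ≤ R → ‖b‖ ≤ R → ‖nonlin f a - nonlin f b‖ ≤ K * ‖a - b‖)
    {b : ℂ} (hb : ‖b‖ ≤ R) : |potential f b| ≤ K * ‖b‖ ^ 2 := by
  simpa [potential_zero, nonlin_zero] using
    abs_potential_sub_le hf hK0 hK (a := 0) (b := b) (by simpa using hR) hb

theorem continuous_potential (hf : ContinuousOn f (Set.Ici 0)) : Continuous (potential f) := by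
  have hfc : Continuous fun s => f (max s 0) :=
    hf.comp_continuous (continuous_id.max continuous_const) fun s => le_max_right s 0
  have h1 : potential f = fun z : ℂ => (∫ s in (0 : ℝ)..‖z‖ ^ 2, f (max s 0)) / 2 := by
    funext z
    rw [potential]
    congr 1
    refine intervalIntegral.integral_congr fun s hs => ?_
    rw [Set.uIcc_of_le (by positivity)] at hs
    simp only [max_eq_left hs.1]
  rw [h1]
  exact ((intervalIntegral.continuous_primitive (fun a b => hfc.intervalIntegrable a b) 0).comp
    (continuous_norm.pow 2)).div_const 2

theorem integrable_potential (hL : LocallyLipschitz (nonlin f)) (hf : ContinuousOn f (Set.Ici 0)) (v : H1) :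
    Integrable fun x => potential f (toL2 v x) := by
  obtain ⟨K, hK0, hK⟩ := exists_lipschitz_nonlin hL ‖v‖
  refine ((integrable_norm_sq (toL2 v)).const_mul K).mono'
    ((continuous_potential hf).comp_aestronglyMeasurable (Lp.aestronglyMeasurable _)) ?_
  filter_upwards [norm_le_of_H1 v] with x hx
  exact abs_potential_le hf (norm_nonneg _) hK0 hK hx

theorem integrable_bcf_mul (m : ℝ →ᵇ ℝ) {g : ℝ → ℝ} (hg : Integrable g) :
    Integrable fun x => m x * g x :=
  hg.bdd_mul m.continuous.aestronglyMeasurable (Eventually.of_forall m.norm_coe_le_norm)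

/-- The weighted potential energy `∫ m G(v)`. -/
def potentialInt (f : ℝ → ℝ) (m : ℝ →ᵇ ℝ) (v : H1) : ℝ := ∫ x, m x * potential f (toL2 v x)

/-- First order expansion of the weighted potential energy, with an `L²` remainder. -/
theorem exists_potentialInt_sub_le (hf : ContinuousOn f (Set.Ici 0)) (R : ℝ) :
    ∃ K : ℝ, 0 ≤ K ∧ ∀ (m : ℝ →ᵇ ℝ) (v w : H1), ‖v‖ ≤ R → ‖w‖ ≤ R →
      |potentialInt f m w - potentialInt f m v
        - (⟪mulOp m (nonlinL2 hL v), toL2 w - toL2 v⟫_ℂ).re|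
        ≤ ‖m‖ * K * ‖toL2 w - toL2 v‖ ^ 2 := by
  obtain ⟨K, hK0, hK⟩ := exists_lipschitz_nonlin hL R
  refine ⟨K, hK0, fun m v w hv hw => ?_⟩
  have i1 := integrable_bcf_mul m (integrable_potential hL hf v)
  have i2 := integrable_bcf_mul m (integrable_potential hL hf w)
  have i3 := integrable_real_inner (mulOp m (nonlinL2 hL v)) (toL2 w - toL2 v)
  have i4 : Integrable fun x => m x * potential f (toL2 w x) - m x * potential f (toL2 v x) :=
    i2.sub i1
  rw [potentialInt, potentialInt, re_inner_eq_integral, ← integral_sub i2 i1,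
    ← integral_sub i4 i3, norm_sq_eq_integral, ← integral_const_mul, ← Real.norm_eq_abs]
  refine norm_integral_le_of_norm_le ((integrable_norm_sq _).const_mul _) ?_
  filter_upwards [coeFn_nonlinL2 hL v, norm_le_of_H1 v, norm_le_of_H1 w,
    coeFn_mulOp m (nonlinL2 hL v), Lp.coeFn_sub (toL2 w) (toL2 v)] with x h1 h2 h3 h4 h5
  have h6 := abs_potential_sub_le hf hK0 hK (h2.trans hv) (h3.trans hw)
  have h7 : ((m x : ℝ) : ℂ) * nonlin f (toL2 v x) = m x • nonlin f (toL2 v x) :=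
    Complex.real_smul.symm
  rw [h4, h5, h1, h7, Pi.sub_apply, real_inner_smul_left, ← mul_sub, ← mul_sub, norm_mul, mul_assoc]
  exact mul_le_mul (m.norm_coe_le_norm x) h6 (norm_nonneg _) (norm_nonneg _)

theorem hasDerivAt_zero_of_le {g b : ℝ → ℝ} {t : ℝ} (hb : HasDerivAt b 0 t) (hbt : b t = 0)
    (hle : ∀ᶠ s in 𝓝 t, |g s - g t| ≤ b s) : HasDerivAt g 0 t := by
  rw [hasDerivAt_iff_isLittleO] at hb ⊢
  simp only [smul_zero, sub_zero, hbt] at hb ⊢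
  refine (Asymptotics.IsBigO.of_bound 1 ?_).trans_isLittleO hb
  filter_upwards [hle] with s hs
  rw [one_mul, Real.norm_eq_abs]
  exact hs.trans (le_abs_self _)

/-- Chain rule in weak form: `∫ m Re(v̄' N(v)) = -∫ m' G(v)`. -/
theorem re_inner_mulOp_grad_nonlinL2 (hf : ContinuousOn f (Set.Ici 0)) (m m' : ℝ →ᵇ ℝ)
    (hm' : ∀ x, HasDerivAt m (m' x) x) (v : H1) :
    (⟪mulOp m (nonlinL2 hL v), grad v⟫_ℂ).re = -potentialInt f m' v := by
  obtain ⟨K, hK0, hK⟩ := exists_potentialInt_sub_le hL hf ‖v‖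
  have h1 : HasDerivAt (fun h => potentialInt f m (transH1 h v))
      (⟪mulOp m (nonlinL2 hL v), grad v⟫_ℂ).re 0 := by
    have h2 : HasDerivAt (fun h => (⟪mulOp m (nonlinL2 hL v), trans h (toL2 v)⟫_ℂ).re)
        (⟪mulOp m (nonlinL2 hL v), grad v⟫_ℂ).re 0 := by
      have h3 := (hasDerivAt_const (0 : ℝ) (mulOp m (nonlinL2 hL v))).inner ℂ
        ((isWeakDeriv_grad v).hasDerivAt_trans 0)
      rw [inner_zero_left, add_zero, trans_zero] at h3
      exact Complex.reCLM.hasFDerivAt.comp_hasDerivAt (0 : ℝ) h3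
    have h4 : HasDerivAt (fun h => potentialInt f m (transH1 h v)
        - (⟪mulOp m (nonlinL2 hL v), trans h (toL2 v)⟫_ℂ).re) 0 0 := by
      refine hasDerivAt_zero_of_le (b := fun h => (‖m‖ * K * ‖grad v‖ ^ 2) * h ^ 2) ?_ (by simp)
        (Eventually.of_forall fun h => ?_)
      · simpa using (hasDerivAt_pow 2 (0 : ℝ)).const_mul (‖m‖ * K * ‖grad v‖ ^ 2)
      · have h5 := hK m v (transH1 h v) le_rfl (norm_transH1 h v).le
        have h6 : transH1 0 v = v := toL2_injective (trans_zero _)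
        rw [h6, trans_zero]
        rw [toL2_transH1, inner_sub_right, Complex.sub_re] at h5
        have h7 : ‖trans h (toL2 v) - toL2 v‖ ^ 2 ≤ ‖grad v‖ ^ 2 * h ^ 2 := by
          have := norm_trans_sub_le v h
          calc _ ≤ (‖grad v‖ * |h|) ^ 2 := by gcongr
            _ = _ := by rw [mul_pow, sq_abs]
        calc _ = |potentialInt f m (transH1 h v) - potentialInt f m v -
              ((⟪mulOp m (nonlinL2 hL v), trans h (toL2 v)⟫_ℂ).re
                - (⟪mulOp m (nonlinL2 hL v), toL2 v⟫_ℂ).re)| := by congr 1; ring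
          _ ≤ _ := h5
          _ ≤ ‖m‖ * K * (‖grad v‖ ^ 2 * h ^ 2) := by gcongr
          _ = _ := by ring
    exact ((h4.add h2).congr_deriv (zero_add _)).congr_of_eventuallyEq
      (Eventually.of_forall fun h => by simp)
  have h8 : (fun h => potentialInt f m (transH1 h v))
      = fun h => ∫ x, m (x - h) * potential f (toL2 v x) := by
    funext h
    rw [potentialInt, ← integral_add_right_eq_self (fun x => m (x - h) * potential f (toL2 v x)) h]
    refine integral_congr_ae ?_
    filter_upwards [coeFn_trans h (toL2 v)] with x hx
    rw [toL2_transH1, hx, add_sub_cancel_right]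
  have hint := integrable_potential hL hf v
  have h9 := (hasDerivAt_integral_of_dominated_loc_of_deriv_le (μ := volume) (x₀ := (0 : ℝ))
    (F := fun h x => m (x - h) * potential f (toL2 v x))
    (F' := fun h x => -m' (x - h) * potential f (toL2 v x))
    (bound := fun x => ‖m'‖ * ‖potential f (toL2 v x)‖) (s := Set.univ) univ_mem
    (Eventually.of_forall fun h => ((m.continuous.comp (continuous_id.sub
      continuous_const)).aestronglyMeasurable).mul hint.aestronglyMeasurable)
    (by simpa using integrable_bcf_mul m hint)
    (((m'.continuous.comp (continuous_id.sub
      continuous_const)).neg.aestronglyMeasurable).mul hint.aestronglyMeasurable)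
    (Eventually.of_forall fun x h _ => by
      rw [norm_mul, norm_neg]
      exact mul_le_mul_of_nonneg_right (m'.norm_coe_le_norm _) (norm_nonneg _))
    (hint.norm.const_mul _)
    (Eventually.of_forall fun x h _ => by
      have := (hm' (x - h)).scomp h ((hasDerivAt_id h).const_sub x)
      simpa using this.mul_const (potential f (toL2 v x)))).2
  rw [h8] at h1
  rw [h1.unique h9, potentialInt, ← integral_neg]
  simp

end

/-! ### Difference quotients -/

/-- The difference quotient `v ↦ (v(· + h) - v) / h` on `L²`. -/
def diffQ (h : ℝ) : L2 →L[ℂ] L2 :=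
  ((h⁻¹ : ℝ) : ℂ) • ((trans h).toContinuousLinearMap - ContinuousLinearMap.id ℂ L2)

theorem diffQ_apply (h : ℝ) (v : L2) : diffQ h v = ((h⁻¹ : ℝ) : ℂ) • (trans h v - v) := rfl

/-- The difference quotient on `H¹`. -/
def diffQH1 (h : ℝ) : H1 →L[ℂ] H1 :=
  ((h⁻¹ : ℝ) : ℂ) • (transH1 h - ContinuousLinearMap.id ℂ H1)

theorem inner_diffQ_left (h : ℝ) (v w : L2) : ⟪diffQ h v, w⟫_ℂ = -⟪v, diffQ (-h) w⟫_ℂ := by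
  rw [diffQ_apply, diffQ_apply, inner_smul_left, inner_smul_right, inner_sub_left, inner_sub_right,
    inner_trans_left, Complex.conj_ofReal]
  push_cast
  rw [inv_neg]
  ring

theorem norm_diffQ_le (h : ℝ) (v : H1) : ‖diffQ h (toL2 v)‖ ≤ ‖grad v‖ := by
  rw [diffQ_apply, norm_smul, Complex.norm_real, norm_inv, Real.norm_eq_abs]
  rcases eq_or_ne h 0 with rfl | hh
  · simp
  · rw [inv_mul_le_iff₀ (abs_pos.2 hh), mul_comm]
    exact norm_trans_sub_le v h

theorem tendsto_diffQ (v : H1) : Tendsto (fun h => diffQ h (toL2 v)) (𝓝[≠] 0) (𝓝 (grad v)) := by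
  have h1 := ((isWeakDeriv_grad v).hasDerivAt_trans 0).tendsto_slope
  rw [trans_zero] at h1
  refine h1.congr fun h => ?_
  rw [slope_def_module, sub_zero, trans_zero, diffQ_apply, Complex.coe_smul]
  rfl

/-- The antisymmetric central difference quotient on `L²`. -/
def centralQ (h : ℝ) : L2 →L[ℂ] L2 := (1 / 2 : ℂ) • (diffQ h + diffQ (-h))

/-- The central difference quotient on `H¹`. -/
def centralQH1 (h : ℝ) : H1 →L[ℂ] H1 := (1 / 2 : ℂ) • (diffQH1 h + diffQH1 (-h))

theorem centralQ_apply (h : ℝ) (v : L2) :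
    centralQ h v = (1 / 2 : ℂ) • (diffQ h v + diffQ (-h) v) := rfl

theorem inner_centralQ_left (h : ℝ) (v w : L2) : ⟪centralQ h v, w⟫_ℂ = -⟪v, centralQ h w⟫_ℂ := by
  rw [centralQ_apply, centralQ_apply, inner_smul_left, inner_smul_right, inner_add_left,
    inner_add_right, inner_diffQ_left, inner_diffQ_left, neg_neg]
  have : (starRingEnd ℂ) (1 / 2) = 1 / 2 := by simp [Complex.conj_ofNat]
  rw [this]
  ring

theorem norm_centralQ_le (h : ℝ) (v : H1) : ‖centralQ h (toL2 v)‖ ≤ ‖grad v‖ := by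
  rw [centralQ_apply, norm_smul]
  have h1 := norm_add_le (diffQ h (toL2 v)) (diffQ (-h) (toL2 v))
  have h2 := norm_diffQ_le h v
  have h3 := norm_diffQ_le (-h) v
  have : ‖(1 / 2 : ℂ)‖ = 1 / 2 := by simp
  rw [this]
  linarith

theorem tendsto_centralQ (v : H1) :
    Tendsto (fun h => centralQ h (toL2 v)) (𝓝[≠] 0) (𝓝 (grad v)) := by
  have hneg : Tendsto (fun h : ℝ => -h) (𝓝[≠] 0) (𝓝[≠] 0) := by
    refine tendsto_nhdsWithin_iff.2 ⟨?_, ?_⟩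
    · exact (continuous_neg.tendsto' (0 : ℝ) 0 neg_zero).mono_left nhdsWithin_le_nhds
    · filter_upwards [self_mem_nhdsWithin] with h hh
      exact neg_ne_zero.2 hh
  have h1 := ((tendsto_diffQ v).add ((tendsto_diffQ v).comp hneg)).const_smul (1 / 2 : ℂ)
  have h2 : (1 / 2 : ℂ) • (grad v + grad v) = grad v := by
    rw [← two_smul ℂ, smul_smul]; norm_num
  rw [h2] at h1
  exact h1

/-! ### Differentiation of quadratic quantities along solutions -/

open ContinuousLinearMap (adjoint)

theorem hasDerivAt_inner_sub {E : Type*} [NormedAddCommGroup E] [InnerProductSpace ℂ E]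
    {a Y : ℝ → E} {Y' : E} {t : ℝ} (ha : ContinuousAt a t) (hY : HasDerivAt Y Y' t) :
    HasDerivAt (fun s => ⟪a s, Y s - Y t⟫_ℂ) ⟪a t, Y'⟫_ℂ t := by
  rw [hasDerivAt_iff_tendsto_slope]
  have h1 := (ha.tendsto.mono_left nhdsWithin_le_nhds).inner (𝕜 := ℂ) hY.tendsto_slope
  refine h1.congr fun s => ?_
  rw [slope_def_module, slope_def_module, sub_self, inner_zero_right, sub_zero,
    inner_smul_right_eq_smul]

section

variable {f : ℝ → ℝ} {u : ℝ → H1}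

theorem inner_smul_right_H1 (c : ℂ) (v w : H1) : ⟪v, c • w⟫_ℂ = c * ⟪v, w⟫_ℂ :=
  inner_smul_right v w c

/-- The equation `u_t = -i(∂*∂ u + N(u))` in the dual of `H¹`, identified with `H¹` by the
Riesz isomorphism, so that `L²` sits in it through the adjoint of the inclusion. -/
theorem IsGlobalSolution.hasDerivAt (hu : IsGlobalSolution f u)
    (hL : LocallyLipschitz (nonlin f)) (t : ℝ) :
    HasDerivAt (fun s => adjoint toL2 (toL2 (u s)))
      (-Complex.I • (adjoint grad (grad (u t)) + adjoint toL2 (nonlinL2 hL (u t)))) t := by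
  set g : ℝ → H1 := fun t =>
    -Complex.I • (adjoint grad (grad (u t)) + adjoint toL2 (nonlinL2 hL (u t))) with hg
  have huc := hu.continuous
  have hgc : Continuous g := by
    have h1 := (continuous_nonlinL2 hL).comp huc
    have h2 : Continuous fun t => adjoint toL2 (nonlinL2 hL (u t)) :=
      (adjoint toL2).continuous.comp h1
    have h3 : Continuous fun t => adjoint grad (grad (u t)) :=
      (adjoint grad).continuous.comp (grad.continuous.comp huc)
    exact (h3.add h2).const_smul (-Complex.I)
  have hFTC : ∀ k, adjoint toL2 (toL2 (u k)) = adjoint toL2 (toL2 (u 0)) + ∫ s in (0 : ℝ)..k, g s := by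
    intro k
    rw [← sub_eq_zero]
    refine eq_zero_of_inner_testH1 _ fun φ hφ => ?_
    have e1 : ∀ v : L2, ⟪testH1 hφ, adjoint toL2 v⟫_ℂ = ⟪testL2 hφ, v⟫_ℂ := fun v =>
      ContinuousLinearMap.adjoint_inner_right _ _ _
    have e2 : ∀ v : L2, ⟪testH1 hφ, adjoint grad v⟫_ℂ = ⟪testL2 hφ.deriv, v⟫_ℂ := fun v =>
      ContinuousLinearMap.adjoint_inner_right _ _ _
    have hd : ∀ s, HasDerivAt (fun s => ⟪testL2 hφ, toL2 (u s)⟫_ℂ) ⟪testH1 hφ, g s⟫_ℂ s := by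
      intro s
      have h1 := (hu.equation φ hφ s).const_mul (-Complex.I)
      have e3 : (fun s => ⟪testL2 hφ, toL2 (u s)⟫_ℂ)
          = fun s => -Complex.I * (Complex.I * ∫ x, (u s).fn x * (φ x : ℂ)) := by
        funext s
        rw [inner_testL2, ← mul_assoc, neg_mul, Complex.I_mul_I, neg_neg, one_mul]
        rfl
      have e4 : ⟪testL2 hφ, nonlinL2 hL (u s)⟫_ℂ = ∫ x, nonlin f ((u s).fn x) * (φ x : ℂ) := by
        rw [inner_testL2]
        refine integral_congr_ae ?_
        filter_upwards [coeFn_nonlinL2 hL (u s)] with x hx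
        rw [hx]
        rfl
      rw [e3]
      refine h1.congr_deriv ?_
      simp only [hg]
      rw [inner_smul_right_H1, inner_add_right, e1, e2, e4, inner_testL2]
      rfl
    have hci : Continuous fun s => ⟪testH1 hφ, g s⟫_ℂ := continuous_const.inner hgc
    have h6 := intervalIntegral.integral_eq_sub_of_hasDerivAt (a := 0) (b := k)
      (fun s _ => hd s) (hci.intervalIntegrable 0 k)
    have h7 := ContinuousLinearMap.intervalIntegral_comp_comm (innerSL ℂ (testH1 hφ))
      (hgc.intervalIntegrable (μ := volume) 0 k)
    simp only [innerSL_apply_apply] at h7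
    rw [inner_sub_right, inner_add_right, ← h7, h6, e1, e1]
    ring
  exact ((intervalIntegral.integral_hasDerivAt_right (hgc.intervalIntegrable _ _)
      hgc.stronglyMeasurable.stronglyMeasurableAtFilter hgc.continuousAt).const_add _
      ).congr_of_eventuallyEq (Eventually.of_forall hFTC)

theorem inner_equation (hL : LocallyLipschitz (nonlin f)) (v w : H1) :
    ⟪v, -Complex.I • (adjoint grad (grad w) + adjoint toL2 (nonlinL2 hL w))⟫_ℂ
      = -Complex.I * (⟪grad v, grad w⟫_ℂ + ⟪toL2 v, nonlinL2 hL w⟫_ℂ) := by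
  rw [inner_smul_right_H1, inner_add_right, ContinuousLinearMap.adjoint_inner_right,
    ContinuousLinearMap.adjoint_inner_right]

theorem re_neg_I_mul (z : ℂ) : (-Complex.I * z).re = z.im := by simp

/-- Derivative of `⟨L u, u⟩` along a solution, for symmetric `L` that preserves `H¹`. -/
theorem IsGlobalSolution.hasDerivAt_form (hu : IsGlobalSolution f u)
    (hL : LocallyLipschitz (nonlin f)) {L : L2 →L[ℂ] L2} {LH : H1 →L[ℂ] H1}
    (hLH : ∀ v, toL2 (LH v) = L (toL2 v)) (hsym : ∀ v w, ⟪L v, w⟫_ℂ = ⟪v, L w⟫_ℂ) (t : ℝ) :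
    HasDerivAt (fun s => (⟪L (toL2 (u s)), toL2 (u s)⟫_ℂ).re)
      (2 * (⟪grad (LH (u t)), grad (u t)⟫_ℂ + ⟪L (toL2 (u t)), nonlinL2 hL (u t)⟫_ℂ).im) t := by
  have hY := hu.hasDerivAt hL t
  have hc : Continuous fun s => LH (u s + u t) :=
    LH.continuous.comp (hu.continuous.add continuous_const)
  have h1 := Complex.reCLM.hasFDerivAt.comp_hasDerivAt t (hasDerivAt_inner_sub hc.continuousAt hY)
  have h2 := h1.add_const ((⟪L (toL2 (u t)), toL2 (u t)⟫_ℂ).re)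
  refine (h2.congr_deriv ?_).congr_of_eventuallyEq (Eventually.of_forall fun s => ?_)
  · rw [inner_equation, Complex.reCLM_apply, re_neg_I_mul, hLH, map_add LH, map_add grad,
      map_add toL2, map_add L, inner_add_left, inner_add_left]
    simp only [Complex.add_im]
    ring
  · simp only [Function.comp_apply, Complex.reCLM_apply]
    rw [← map_sub (adjoint toL2), ContinuousLinearMap.adjoint_inner_right, hLH, map_add, map_add, inner_add_left,
      inner_sub_right, inner_sub_right, ← Complex.add_re]
    have e : (⟪L (toL2 (u s)), toL2 (u t)⟫_ℂ).re = (⟪L (toL2 (u t)), toL2 (u s)⟫_ℂ).re := by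
      rw [hsym, ← inner_conj_symm, Complex.conj_re]
    simp only [Complex.add_re, Complex.sub_re, e]
    ring

theorem inner_mulOp_nonlinL2_im (hL : LocallyLipschitz (nonlin f)) (m : ℝ →ᵇ ℝ) (v : H1) :
    (⟪mulOp m (toL2 v), nonlinL2 hL v⟫_ℂ).im = 0 := by
  rw [← Complex.conj_eq_iff_im, inner_conj_symm, L2.inner_def, L2.inner_def]
  refine integral_congr_ae ?_
  filter_upwards [coeFn_mulOp m (toL2 v), coeFn_nonlinL2 hL v] with x h1 h2
  rw [h1, h2, RCLike.inner_apply, RCLike.inner_apply, nonlin]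
  simp only [map_mul, Complex.conj_ofReal]
  ring

theorem mulOp_one (v : L2) : mulOp 1 v = v := by
  apply Lp.ext
  filter_upwards [coeFn_mulOp 1 v] with x h1
  rw [h1]; simp

theorem inner_self_im (v : L2) : (⟪v, v⟫_ℂ).im = 0 := by
  rw [inner_self_eq_norm_sq_to_K]
  have : ((‖v‖ : ℂ) ^ 2).im = 0 := by norm_cast
  exact this

theorem inner_self_re (v : L2) : (⟪v, v⟫_ℂ).re = ‖v‖ ^ 2 := by
  rw [inner_self_eq_norm_sq_to_K]
  have : ((‖v‖ : ℂ) ^ 2).re = ‖v‖ ^ 2 := by norm_cast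
  exact this

theorem IsGlobalSolution.mass_eq (hu : IsGlobalSolution f u)
    (hL : LocallyLipschitz (nonlin f)) (t : ℝ) : ‖toL2 (u t)‖ = ‖toL2 (u 0)‖ := by
  have h1 : ∀ t, HasDerivAt (fun s => ‖toL2 (u s)‖ ^ 2) 0 t := by
    intro t
    have h2 := hu.hasDerivAt_form hL (L := ContinuousLinearMap.id ℂ L2)
      (LH := ContinuousLinearMap.id ℂ H1) (fun _ => rfl) (fun _ _ => rfl) t
    simp only [ContinuousLinearMap.id_apply, inner_self_re] at h2
    refine h2.congr_deriv ?_
    have h3 := inner_mulOp_nonlinL2_im hL 1 (u t)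
    rw [mulOp_one] at h3
    rw [Complex.add_im, inner_self_im, h3]
    ring
  have h4 := is_const_of_deriv_eq_zero (fun t => (h1 t).differentiableAt) (fun t => (h1 t).deriv)
    t 0
  exact (sq_eq_sq₀ (norm_nonneg _) (norm_nonneg _)).1 h4

/-- Derivative of the potential energy. The quadratic remainder is negligible because
`‖u(s) - u(t)‖²_{L²}`, the pairing of `u(s) - u(t) → 0` in `H¹` with a difference quotient that
converges in the dual, is `o(s - t)`. -/
theorem IsGlobalSolution.hasDerivAt_potentialInt (hu : IsGlobalSolution f u)
    (hL : LocallyLipschitz (nonlin f)) (hf : ContinuousOn f (Set.Ici 0)) (t : ℝ) :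
    HasDerivAt (fun s => potentialInt f 1 (u s))
      (⟪grad (nonlinH1 hL (u t)), grad (u t)⟫_ℂ).im t := by
  obtain ⟨K, hK0, hK⟩ := exists_potentialInt_sub_le hL hf (‖u t‖ + 1)
  have hY := hu.hasDerivAt hL t
  have h1 := Complex.reCLM.hasFDerivAt.comp_hasDerivAt t
    (hasDerivAt_inner_sub (a := fun _ => nonlinH1 hL (u t)) continuousAt_const hY)
  have h2 := Complex.reCLM.hasFDerivAt.comp_hasDerivAt t
    (hasDerivAt_inner_sub (a := fun s => u s - u t)
      (hu.continuous.sub continuous_const).continuousAt hY)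
  rw [sub_self, inner_zero_left] at h2
  have hsmall : ∀ᶠ s in 𝓝 t, ‖u s‖ ≤ ‖u t‖ + 1 := by
    filter_upwards [(hu.continuous.norm.tendsto t).eventually_lt_const
      (show ‖u t‖ < ‖u t‖ + 1 by linarith)] with s hs using hs.le
  have h3 := h2.const_mul (‖(1 : ℝ →ᵇ ℝ)‖ * K)
  rw [map_zero, mul_zero] at h3
  have h4 := hasDerivAt_zero_of_le (g := fun s => potentialInt f 1 (u s)
      - (⟪nonlinL2 hL (u t), toL2 (u s) - toL2 (u t)⟫_ℂ).re) h3 (by simp) (by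
    filter_upwards [hsmall] with s hs
    have h5 := hK 1 (u t) (u s) (by linarith) hs
    rw [mulOp_one] at h5
    simp only [Function.comp_apply, Complex.reCLM_apply, sub_self, inner_zero_right,
      Complex.zero_re, sub_zero]
    rw [← map_sub (adjoint toL2), ContinuousLinearMap.adjoint_inner_right, ← map_sub, inner_self_re, map_sub]
    calc _ = |potentialInt f 1 (u s) - potentialInt f 1 (u t)
          - (⟪nonlinL2 hL (u t), toL2 (u s) - toL2 (u t)⟫_ℂ).re| := by congr 1; ring
      _ ≤ _ := h5)
  refine ((h4.add h1).congr_deriv ?_).congr_of_eventuallyEq (Eventually.of_forall fun s => ?_)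
  · rw [inner_equation, Complex.reCLM_apply, re_neg_I_mul, toL2_nonlinH1, Complex.add_im,
      inner_self_im]
    ring
  · simp only [Pi.add_apply, Function.comp_apply, Complex.reCLM_apply]
    rw [← map_sub (adjoint toL2), ContinuousLinearMap.adjoint_inner_right, toL2_nonlinH1]
    ring

/-- The energy `½‖v'‖² + ∫ G(v)`. -/
def energy (f : ℝ → ℝ) (v : H1) : ℝ := ‖grad v‖ ^ 2 / 2 + potentialInt f 1 v

theorem IsGlobalSolution.hasDerivAt_diffQ (hu : IsGlobalSolution f u)
    (hL : LocallyLipschitz (nonlin f)) (h t : ℝ) :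
    HasDerivAt (fun s => ‖diffQ h (toL2 (u s))‖ ^ 2)
      (2 * (⟪diffQ h (toL2 (u t)), diffQ h (nonlinL2 hL (u t))⟫_ℂ).im) t := by
  have hin : ∀ v w : L2, ⟪(-(diffQ (-h)).comp (diffQ h)) v, w⟫_ℂ = ⟪diffQ h v, diffQ h w⟫_ℂ := by
    intro v w
    change ⟪-(diffQ (-h) (diffQ h v)), w⟫_ℂ = _
    rw [inner_neg_left, inner_diffQ_left, neg_neg, neg_neg]
  have h1 := hu.hasDerivAt_form hL (L := -(diffQ (-h)).comp (diffQ h))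
    (LH := -(diffQH1 (-h)).comp (diffQH1 h)) (fun v => rfl) (fun v w => by
      rw [hin, ← inner_conj_symm v, hin, inner_conj_symm]) t
  have e : grad ((-(diffQH1 (-h)).comp (diffQH1 h)) (u t))
      = (-(diffQ (-h)).comp (diffQ h)) (grad (u t)) := rfl
  simp only [e, hin, inner_self_re] at h1
  rwa [Complex.add_im, inner_self_im, zero_add] at h1

theorem IsGlobalSolution.energy_eq (hu : IsGlobalSolution f u)
    (hL : LocallyLipschitz (nonlin f)) (hf : ContinuousOn f (Set.Ici 0)) (t : ℝ) :
    energy f (u t) = energy f (u 0) := by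
  -- bounds on the compact time interval, uniform in the step of the difference quotient
  obtain ⟨R, hR⟩ := (isCompact_uIcc (a := (0 : ℝ)) (b := t)).exists_bound_of_continuousOn
    hu.continuous.continuousOn
  obtain ⟨K, hK0, hK⟩ := exists_norm_grad_nonlinH1_le hL R
  have hR0 : 0 ≤ R := (norm_nonneg _).trans (hR 0 Set.left_mem_uIcc)
  set p : ℝ → ℝ := fun s => (⟪grad (nonlinH1 hL (u s)), grad (u s)⟫_ℂ).im with hp
  set q : ℝ → ℝ → ℝ := fun h s =>
    (⟪diffQ h (toL2 (u s)), diffQ h (nonlinL2 hL (u s))⟫_ℂ).im with hq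
  have hbp : ∀ s ∈ Set.uIcc 0 t, ‖p s‖ ≤ K * R * R := by
    intro s hs
    have h1 := norm_grad_le (u s)
    calc ‖p s‖ ≤ ‖⟪grad (nonlinH1 hL (u s)), grad (u s)⟫_ℂ‖ := Complex.abs_im_le_norm _
      _ ≤ ‖grad (nonlinH1 hL (u s))‖ * ‖grad (u s)‖ := norm_inner_le_norm _ _
      _ ≤ (K * ‖grad (u s)‖) * ‖grad (u s)‖ := by gcongr; exact hK _ (hR s hs)
      _ ≤ (K * R) * R := by
        have := h1.trans (hR s hs)
        gcongr
  have hbq : ∀ h, ∀ s ∈ Set.uIcc 0 t, ‖q h s‖ ≤ K * R * R := by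
    intro h s hs
    have h1 := norm_grad_le (u s)
    have h2 := norm_diffQ_le h (u s)
    have h3 := norm_diffQ_le h (nonlinH1 hL (u s))
    have h4 := hK _ (hR s hs)
    calc ‖q h s‖ ≤ ‖⟪diffQ h (toL2 (u s)), diffQ h (nonlinL2 hL (u s))⟫_ℂ‖ :=
          Complex.abs_im_le_norm _
      _ ≤ ‖diffQ h (toL2 (u s))‖ * ‖diffQ h (nonlinL2 hL (u s))‖ := norm_inner_le_norm _ _
      _ ≤ R * (K * R) := by
        have h5 := h1.trans (hR s hs)
        refine mul_le_mul (h2.trans h5) (h3.trans (h4.trans ?_)) (norm_nonneg _) hR0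
        gcongr
      _ = _ := by ring
  have hpm : Measurable p := by
    have : p = deriv fun s => potentialInt f 1 (u s) := by
      funext s
      exact ((hu.hasDerivAt_potentialInt hL hf s).deriv).symm
    rw [this]
    exact measurable_deriv _
  have hqc : ∀ h, Continuous (q h) := by
    intro h
    have h1 := (continuous_nonlinL2 hL).comp hu.continuous
    have h2 := toL2.continuous.comp hu.continuous
    exact Complex.continuous_im.comp
      (((diffQ h).continuous.comp h2).inner ((diffQ h).continuous.comp h1))
  have hpi : IntervalIntegrable p volume 0 t := by
    refine (intervalIntegrable_const (c := K * R * R)).mono_fun hpm.aestronglyMeasurable ?_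
    refine (ae_restrict_iff' measurableSet_uIoc).2 (Eventually.of_forall fun s hs => ?_)
    rw [Real.norm_of_nonneg (by positivity : 0 ≤ K * R * R)]
    exact hbp s (Set.uIoc_subset_uIcc hs)
  have hFTC : ∀ h, ∫ s in (0 : ℝ)..t, (q h s + p s)
      = (‖diffQ h (toL2 (u t))‖ ^ 2 / 2 + potentialInt f 1 (u t))
        - (‖diffQ h (toL2 (u 0))‖ ^ 2 / 2 + potentialInt f 1 (u 0)) := by
    intro h
    refine intervalIntegral.integral_eq_sub_of_hasDerivAt
      (f := fun s => ‖diffQ h (toL2 (u s))‖ ^ 2 / 2 + potentialInt f 1 (u s))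
      (fun s _ => ?_) (((hqc h).intervalIntegrable _ _).add hpi)
    refine (((hu.hasDerivAt_diffQ hL h s).div_const 2).add
      (hu.hasDerivAt_potentialInt hL hf s)).congr_deriv ?_
    rw [mul_div_cancel_left₀ _ two_ne_zero]
  have hlim1 : Tendsto (fun h => ∫ s in (0 : ℝ)..t, (q h s + p s)) (𝓝[≠] 0)
      (𝓝 (∫ s in (0 : ℝ)..t, (0 : ℝ))) := by
    refine intervalIntegral.tendsto_integral_filter_of_dominated_convergence
      (fun _ => K * R * R + K * R * R) ?_ ?_ intervalIntegrable_const ?_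
    · exact Eventually.of_forall fun h =>
        ((hqc h).measurable.add hpm).aestronglyMeasurable
    · refine Eventually.of_forall fun h => Eventually.of_forall fun s hs => ?_
      have hs' := Set.uIoc_subset_uIcc hs
      exact (norm_add_le _ _).trans (add_le_add (hbq h s hs') (hbp s hs'))
    · refine Eventually.of_forall fun s _ => ?_
      have h1 := (tendsto_diffQ (u s)).inner (𝕜 := ℂ) (tendsto_diffQ (nonlinH1 hL (u s)))
      have h2 := ((Complex.continuous_im.tendsto _).comp h1).add_const (p s)
      have h3 : (⟪grad (u s), grad (nonlinH1 hL (u s))⟫_ℂ).im + p s = 0 := by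
        rw [hp, ← inner_conj_symm (grad (u s)), Complex.conj_im]
        ring
      rw [h3] at h2
      exact h2
  have hlim2 : Tendsto (fun h => (‖diffQ h (toL2 (u t))‖ ^ 2 / 2 + potentialInt f 1 (u t))
        - (‖diffQ h (toL2 (u 0))‖ ^ 2 / 2 + potentialInt f 1 (u 0))) (𝓝[≠] 0)
      (𝓝 (energy f (u t) - energy f (u 0))) := by
    have h1 : ∀ v : H1, Tendsto (fun h => ‖diffQ h (toL2 v)‖ ^ 2 / 2 + potentialInt f 1 v) (𝓝[≠] 0)
        (𝓝 (energy f v)) := fun v =>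
      ((((tendsto_diffQ v).norm).pow 2).div_const 2).add_const _
    exact (h1 _).sub (h1 _)
  simp only [hFTC] at hlim1
  have := tendsto_nhds_unique hlim1 hlim2
  rw [intervalIntegral.integral_zero] at this
  linarith

end

/-! ### The virial identity -/

section

variable {φ φ' : ℝ →ᵇ ℝ}

/-- The regularized commutator `φ D_h + D_h φ` with the central difference quotient `D_h`. -/
def commQ (φ : ℝ →ᵇ ℝ) (h : ℝ) : L2 →L[ℂ] L2 :=
  (mulOp φ).comp (centralQ h) + (centralQ h).comp (mulOp φ)

theorem commQ_apply (φ : ℝ →ᵇ ℝ) (h : ℝ) (v : L2) :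
    commQ φ h v = mulOp φ (centralQ h v) + centralQ h (mulOp φ v) := rfl

theorem inner_commQ_left (φ : ℝ →ᵇ ℝ) (h : ℝ) (v w : L2) :
    ⟪commQ φ h v, w⟫_ℂ = -⟪v, commQ φ h w⟫_ℂ := by
  rw [commQ_apply, commQ_apply, inner_add_left, inner_add_right, inner_mulOp_left,
    inner_centralQ_left, inner_centralQ_left, inner_mulOp_left]
  ring

theorem re_inner_commQ_self (φ : ℝ →ᵇ ℝ) (h : ℝ) (v : L2) : (⟪commQ φ h v, v⟫_ℂ).re = 0 := by
  have h1 := congrArg Complex.re (inner_commQ_left φ h v v)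
  rw [← inner_conj_symm v, Complex.neg_re, Complex.conj_re] at h1
  linarith

/-- The operator `2 φ ∂ + φ'` from `H¹` to `L²`. -/
def dilation (φ φ' : ℝ →ᵇ ℝ) : H1 →L[ℂ] L2 :=
  (2 : ℂ) • (mulOp φ).comp grad + (mulOp φ').comp toL2

theorem dilation_apply (φ φ' : ℝ →ᵇ ℝ) (v : H1) :
    dilation φ φ' v = (2 : ℂ) • mulOp φ (grad v) + mulOp φ' (toL2 v) := rfl

theorem tendsto_commQ (hφ : ContDiff ℝ ∞ φ) (hφ' : ∀ x, HasDerivAt φ (φ' x) x) (v : H1) :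
    Tendsto (fun h => commQ φ h (toL2 v)) (𝓝[≠] 0) (𝓝 (dilation φ φ' v)) := by
  have h1 := (((mulOp φ).continuous.tendsto _).comp (tendsto_centralQ v)).add
    (tendsto_centralQ (mulH1 φ φ' hφ hφ' v))
  rw [grad_mulH1, ← add_assoc, ← two_smul ℂ] at h1
  exact h1

theorem norm_commQ_le (hφ : ContDiff ℝ ∞ φ) (hφ' : ∀ x, HasDerivAt φ (φ' x) x) (h : ℝ) (v : H1) :
    ‖commQ φ h (toL2 v)‖ ≤ ‖φ‖ * ‖grad v‖ + ‖grad (mulH1 φ φ' hφ hφ' v)‖ := by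
  rw [commQ_apply]
  refine (norm_add_le _ _).trans (add_le_add ?_ ?_)
  · exact (norm_mulOp_le _ _).trans
      (mul_le_mul_of_nonneg_left (norm_centralQ_le h v) (norm_nonneg _))
  · exact norm_centralQ_le h (mulH1 φ φ' hφ hφ' v)

end

/-- The virial identity: with `Q = -Im ⟨(2φ∂ + φ')u, u⟩`, the increment of `Q` is the time integral
of `2 Re (⟨(2φ'∂ + φ'')u, ∂u⟩ + ⟨(2φ∂ + φ')u, N(u)⟩)`. It is the limit of exact identities for
the symmetric bounded operators `-i (φ D_h + D_h φ)`. -/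
theorem IsGlobalSolution.virial {f : ℝ → ℝ} (hL : LocallyLipschitz (nonlin f)) {u : ℝ → H1}
    (hu : IsGlobalSolution f u) {φ φ' φ'' : ℝ →ᵇ ℝ} (hφ : ContDiff ℝ ∞ φ) (hφ2 : ContDiff ℝ ∞ φ')
    (hφ' : ∀ x, HasDerivAt φ (φ' x) x) (hφ'' : ∀ x, HasDerivAt φ' (φ'' x) x) (t : ℝ) :
    ∫ s in (0 : ℝ)..t, 2 * (⟪dilation φ' φ'' (u s), grad (u s)⟫_ℂ
        + ⟪dilation φ φ' (u s), nonlinL2 hL (u s)⟫_ℂ).re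
      = -(⟪dilation φ φ' (u t), toL2 (u t)⟫_ℂ).im + (⟪dilation φ φ' (u 0), toL2 (u 0)⟫_ℂ).im := by
  set q : ℝ → ℝ → ℝ := fun h s => 2 * (⟪commQ φ' h (toL2 (u s)), grad (u s)⟫_ℂ
        + ⟪commQ φ h (toL2 (u s)), nonlinL2 hL (u s)⟫_ℂ).re with hq
  have hd : ∀ h s, HasDerivAt (fun s => -(⟪commQ φ h (toL2 (u s)), toL2 (u s)⟫_ℂ).im) (q h s) s := by
    intro h s
    have hIz : ∀ z : ℂ, (Complex.I * z).re = -z.im := fun z => by simp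
    have hIi : ∀ z : ℂ, (Complex.I * z).im = z.re := fun z => by simp
    have hin : ∀ v w : L2, ⟪(-Complex.I • commQ φ h) v, w⟫_ℂ = Complex.I * ⟪commQ φ h v, w⟫_ℂ := by
      intro v w
      change ⟪-Complex.I • commQ φ h v, w⟫_ℂ = _
      rw [inner_smul_left, map_neg, Complex.conj_I, neg_neg]
    have h1 := hu.hasDerivAt_form hL (L := -Complex.I • commQ φ h)
      (LH := -Complex.I • ((mulH1 φ φ' hφ hφ').comp (centralQH1 h)
        + (centralQH1 h).comp (mulH1 φ φ' hφ hφ'))) (fun v => rfl) (fun v w => by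
        rw [hin, ← inner_conj_symm v, hin, map_mul, inner_conj_symm, Complex.conj_I,
          inner_commQ_left]
        ring) s
    have e : grad ((-Complex.I • ((mulH1 φ φ' hφ hφ').comp (centralQH1 h)
        + (centralQH1 h).comp (mulH1 φ φ' hφ hφ'))) (u s))
        = (-Complex.I) • (commQ φ h (grad (u s)) + commQ φ' h (toL2 (u s))) := by
      change (-Complex.I) • ((mulOp φ (centralQ h (grad (u s))) + mulOp φ' (centralQ h (toL2 (u s))))
        + centralQ h (mulOp φ (grad (u s)) + mulOp φ' (toL2 (u s)))) = _
      rw [commQ_apply, commQ_apply, map_add]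
      congr 1
      abel
    simp only [hin, hIz] at h1
    refine h1.congr_deriv ?_
    rw [e, inner_smul_left, map_neg, Complex.conj_I, neg_neg, ← mul_add, hIi, inner_add_left, hq]
    simp only [Complex.add_re, re_inner_commQ_self]
    ring
  have huc := hu.continuous
  have hNc : Continuous fun s => nonlinL2 hL (u s) := (continuous_nonlinL2 hL).comp huc
  have hvc : Continuous fun s => toL2 (u s) := toL2.continuous.comp huc
  have hgc : Continuous fun s => grad (u s) := grad.continuous.comp huc
  have hqc : ∀ h, Continuous (q h) := fun h =>
    continuous_const.mul (Complex.continuous_re.comp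
      ((((commQ φ' h).continuous.comp hvc).inner hgc).add
        (((commQ φ h).continuous.comp hvc).inner hNc)))
  have hFTC : ∀ h, ∫ s in (0 : ℝ)..t, q h s
      = -(⟪commQ φ h (toL2 (u t)), toL2 (u t)⟫_ℂ).im
        - -(⟪commQ φ h (toL2 (u 0)), toL2 (u 0)⟫_ℂ).im := fun h =>
    intervalIntegral.integral_eq_sub_of_hasDerivAt (fun s _ => hd h s)
      ((hqc h).intervalIntegrable _ _)
  let bd : ℝ → ℝ := fun s =>
    2 * ((‖φ'‖ * ‖grad (u s)‖ + ‖grad (mulH1 φ' φ'' hφ2 hφ'' (u s))‖) * ‖grad (u s)‖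
      + (‖φ‖ * ‖grad (u s)‖ + ‖grad (mulH1 φ φ' hφ hφ' (u s))‖) * ‖nonlinL2 hL (u s)‖)
  have hbdc : Continuous bd := by
    have h1 : Continuous fun s => grad (mulH1 φ' φ'' hφ2 hφ'' (u s)) :=
      grad.continuous.comp ((mulH1 φ' φ'' hφ2 hφ'').continuous.comp huc)
    have h2 : Continuous fun s => grad (mulH1 φ φ' hφ hφ' (u s)) :=
      grad.continuous.comp ((mulH1 φ φ' hφ hφ').continuous.comp huc)
    fun_prop
  have hlim1 : Tendsto (fun h => ∫ s in (0 : ℝ)..t, q h s) (𝓝[≠] 0)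
      (𝓝 (∫ s in (0 : ℝ)..t, 2 * (⟪dilation φ' φ'' (u s), grad (u s)⟫_ℂ
        + ⟪dilation φ φ' (u s), nonlinL2 hL (u s)⟫_ℂ).re)) := by
    refine intervalIntegral.tendsto_integral_filter_of_dominated_convergence
      bd ?_ ?_ (hbdc.intervalIntegrable _ _) ?_
    · exact Eventually.of_forall fun h => (hqc h).aestronglyMeasurable
    · refine Eventually.of_forall fun h => Eventually.of_forall fun s _ => ?_
      rw [hq, norm_mul, Real.norm_of_nonneg (by norm_num : (0 : ℝ) ≤ 2)]
      refine mul_le_mul_of_nonneg_left ?_ (by norm_num)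
      refine (Complex.abs_re_le_norm _).trans ((norm_add_le _ _).trans (add_le_add ?_ ?_))
      · exact (norm_inner_le_norm _ _).trans
          (mul_le_mul_of_nonneg_right (norm_commQ_le hφ2 hφ'' h (u s)) (norm_nonneg _))
      · exact (norm_inner_le_norm _ _).trans
          (mul_le_mul_of_nonneg_right (norm_commQ_le hφ hφ' h (u s)) (norm_nonneg _))
    · refine Eventually.of_forall fun s _ => ?_
      have h1 := ((tendsto_commQ hφ2 hφ'' (u s)).inner (𝕜 := ℂ)
        (tendsto_const_nhds (x := grad (u s)))).add
        ((tendsto_commQ hφ hφ' (u s)).inner (𝕜 := ℂ) (tendsto_const_nhds (x := nonlinL2 hL (u s))))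
      exact ((Complex.continuous_re.tendsto _).comp h1).const_mul 2
  have hlim2 : ∀ v : H1, Tendsto (fun h => (⟪commQ φ h (toL2 v), toL2 v⟫_ℂ).im) (𝓝[≠] 0)
      (𝓝 (⟪dilation φ φ' v, toL2 v⟫_ℂ).im) := fun v =>
    (Complex.continuous_im.tendsto _).comp
      ((tendsto_commQ hφ hφ' v).inner (𝕜 := ℂ) tendsto_const_nhds)
  simp only [hFTC] at hlim1
  rw [tendsto_nhds_unique hlim1 ((hlim2 (u t)).neg.sub (hlim2 (u 0)).neg)]
  ring

/-! ### The hyperbolic weights -/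

/-- The hyperbolic secant `1 / cosh` as a bounded continuous function. -/
def sech : ℝ →ᵇ ℝ :=
  BoundedContinuousFunction.ofNormedAddCommGroup (fun x => (Real.cosh x)⁻¹)
    (Real.continuous_cosh.inv₀ fun x => (Real.cosh_pos x).ne') 1 (fun x => by
      rw [Real.norm_of_nonneg (inv_nonneg.2 (Real.cosh_pos x).le)]
      exact inv_le_one_of_one_le₀ (Real.one_le_cosh x))

theorem sech_apply (x : ℝ) : sech x = (Real.cosh x)⁻¹ := rfl

theorem sech_pos (x : ℝ) : 0 < sech x := inv_pos.2 (Real.cosh_pos x)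

/-- The hyperbolic tangent as a bounded continuous function. -/
def tanhB : ℝ →ᵇ ℝ :=
  BoundedContinuousFunction.ofNormedAddCommGroup (fun x => Real.sinh x * (Real.cosh x)⁻¹)
    (Real.continuous_sinh.mul (Real.continuous_cosh.inv₀ fun x => (Real.cosh_pos x).ne')) 1
    (fun x => by
      rw [← div_eq_mul_inv, Real.norm_eq_abs, abs_div, abs_of_pos (Real.cosh_pos x),
        div_le_one (Real.cosh_pos x)]
      exact (sq_le_sq₀ (abs_nonneg _) (Real.cosh_pos x).le).1
        (by rw [sq_abs]; linarith [Real.cosh_sq x]))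

theorem tanhB_apply (x : ℝ) : tanhB x = Real.sinh x * (Real.cosh x)⁻¹ := rfl

theorem tanhB_sq_add_sech_sq (x : ℝ) : tanhB x ^ 2 + sech x ^ 2 = 1 := by
  have := (Real.cosh_pos x).ne'
  rw [tanhB_apply, sech_apply]
  field_simp
  linarith [Real.cosh_sq x]

theorem contDiff_sech : ContDiff ℝ ∞ sech :=
  Real.contDiff_cosh.inv fun x => (Real.cosh_pos x).ne'

theorem contDiff_tanhB : ContDiff ℝ ∞ tanhB :=
  Real.contDiff_sinh.mul contDiff_sech

theorem hasDerivAt_sech (x : ℝ) : HasDerivAt sech ((-(sech * tanhB) : ℝ →ᵇ ℝ) x) x := by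
  have := (Real.cosh_pos x).ne'
  refine ((Real.hasDerivAt_cosh x).inv this).congr_deriv ?_
  simp only [BoundedContinuousFunction.coe_neg, BoundedContinuousFunction.coe_mul, Pi.neg_apply,
    Pi.mul_apply, tanhB_apply, sech_apply]
  field_simp

theorem hasDerivAt_tanhB (x : ℝ) : HasDerivAt tanhB ((sech ^ 2 : ℝ →ᵇ ℝ) x) x := by
  have := (Real.cosh_pos x).ne'
  refine ((Real.hasDerivAt_sinh x).mul (hasDerivAt_sech x)).congr_deriv ?_
  simp only [BoundedContinuousFunction.coe_neg, BoundedContinuousFunction.coe_mul, Pi.neg_apply,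
    Pi.mul_apply, tanhB_apply, sech_apply, BoundedContinuousFunction.coe_pow, Pi.pow_apply]
  field_simp
  linarith [Real.cosh_sq x]

theorem contDiff_sech_sq : ContDiff ℝ ∞ (sech ^ 2 : ℝ →ᵇ ℝ) := contDiff_sech.pow 2

theorem hasDerivAt_sech_sq (x : ℝ) :
    HasDerivAt (sech ^ 2 : ℝ →ᵇ ℝ) (((-2 : ℝ) • (sech ^ 2 * tanhB) : ℝ →ᵇ ℝ) x) x := by
  refine ((hasDerivAt_sech x).pow 2).congr_deriv ?_
  simp
  ring

theorem contDiff_sech_sq_mul_tanhB : ContDiff ℝ ∞ (sech ^ 2 * tanhB : ℝ →ᵇ ℝ) :=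
  contDiff_sech_sq.mul contDiff_tanhB

theorem hasDerivAt_sech_sq_mul_tanhB (x : ℝ) : HasDerivAt (sech ^ 2 * tanhB : ℝ →ᵇ ℝ)
    ((sech ^ 2 * sech ^ 2 - (2 : ℝ) • ((sech * tanhB) * (sech * tanhB)) : ℝ →ᵇ ℝ) x) x := by
  refine ((hasDerivAt_sech_sq x).mul (hasDerivAt_tanhB x)).congr_deriv ?_
  simp
  ring

theorem mulOp_add (m n : ℝ →ᵇ ℝ) (v : L2) : mulOp (m + n) v = mulOp m v + mulOp n v := by
  apply Lp.ext
  filter_upwards [coeFn_mulOp (m + n) v, coeFn_mulOp m v, coeFn_mulOp n v,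
    Lp.coeFn_add (mulOp m v) (mulOp n v)] with x h1 h2 h3 h4
  rw [h4, Pi.add_apply, h1, h2, h3]
  simp [add_mul]

theorem mulOp_smul (c : ℝ) (m : ℝ →ᵇ ℝ) (v : L2) : mulOp (c • m) v = (c : ℂ) • mulOp m v := by
  apply Lp.ext
  filter_upwards [coeFn_mulOp (c • m) v, coeFn_mulOp m v,
    Lp.coeFn_smul (c : ℂ) (mulOp m v)] with x h1 h2 h3
  rw [h3, Pi.smul_apply, h1, h2]
  simp [mul_assoc]

theorem mulOp_neg (m : ℝ →ᵇ ℝ) (v : L2) : mulOp (-m) v = -mulOp m v := by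
  apply Lp.ext
  filter_upwards [coeFn_mulOp (-m) v, coeFn_mulOp m v, Lp.coeFn_neg (mulOp m v)] with x h1 h2 h3
  rw [h3, Pi.neg_apply, h1, h2]
  simp

theorem mulOp_sub (m n : ℝ →ᵇ ℝ) (v : L2) : mulOp (m - n) v = mulOp m v - mulOp n v := by
  rw [sub_eq_add_neg, mulOp_add, mulOp_neg, sub_eq_add_neg]

theorem inner_mulOp_mul (m n : ℝ →ᵇ ℝ) (v w : L2) :
    ⟪mulOp (m * n) v, w⟫_ℂ = ⟪mulOp n v, mulOp m w⟫_ℂ := by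
  rw [← mulOp_mulOp, inner_mulOp_left]

/-! ### Coercivity of the virial form on odd functions -/

/-- The conjugated function `w = sech · v`, in which the virial form has no first order terms. -/
def conjH1 : H1 →L[ℂ] H1 := mulH1 sech (-(sech * tanhB)) contDiff_sech hasDerivAt_sech

theorem toL2_conjH1 (v : H1) : toL2 (conjH1 v) = mulOp sech (toL2 v) := rfl

theorem grad_conjH1 (v : H1) :
    grad (conjH1 v) = mulOp sech (grad v) - mulOp (sech * tanhB) (toL2 v) := by
  rw [sub_eq_add_neg, ← mulOp_neg]
  rfl

/-- The quadratic part of the virial identity for `φ = tanh` is `2 ‖w'‖² - ‖sech w‖²` with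
`w = sech v`. -/
theorem re_inner_dilation_eq (v : H1) :
    (⟪dilation (sech ^ 2) ((-2 : ℝ) • (sech ^ 2 * tanhB)) v, grad v⟫_ℂ).re
      = 2 * ‖grad (conjH1 v)‖ ^ 2 - ‖mulOp (sech ^ 2) (toL2 v)‖ ^ 2 := by
  set a := mulOp sech (grad v) with ha
  set b := mulOp (sech * tanhB) (toL2 v) with hb
  have hab : ⟪mulOp (sech ^ 2 * tanhB) (toL2 v), grad v⟫_ℂ = ⟪b, a⟫_ℂ := by
    rw [show (sech ^ 2 * tanhB : ℝ →ᵇ ℝ) = sech * (sech * tanhB) by ring, inner_mulOp_mul]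
  have h1 : (⟪b, a⟫_ℂ).re = ‖b‖ ^ 2 - ‖mulOp (sech ^ 2) (toL2 v)‖ ^ 2 / 2 := by
    have h2 := (isWeakDeriv_grad (mulH1 _ _ contDiff_sech_sq_mul_tanhB
      hasDerivAt_sech_sq_mul_tanhB v)).inner_eq_neg (isWeakDeriv_grad v)
    have i1 : ⟪mulOp (sech ^ 2 * tanhB) (grad v), toL2 v⟫_ℂ = (starRingEnd ℂ) ⟪b, a⟫_ℂ := by
      rw [inner_mulOp_left, ← inner_conj_symm, hab]
    rw [toL2_mulH1, grad_mulH1, hab, mulOp_sub, mulOp_smul, inner_add_left, inner_sub_left,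
      inner_smul_left, i1, inner_mulOp_mul (sech ^ 2), inner_mulOp_mul (sech * tanhB)] at h2
    have h3 := congrArg Complex.re h2
    simp only [Complex.neg_re, Complex.add_re, Complex.sub_re, Complex.conj_re, Complex.conj_ofReal,
      Complex.re_ofReal_mul, inner_self_re] at h3
    rw [← hb] at h3
    linarith
  have h4 : ‖grad (conjH1 v)‖ ^ 2 = ‖a‖ ^ 2 - 2 * (⟪b, a⟫_ℂ).re + ‖b‖ ^ 2 := by
    rw [grad_conjH1, ← ha, ← hb, ← inner_self_re, inner_sub_left, inner_sub_right, inner_sub_right,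
      ← inner_conj_symm a b]
    simp only [Complex.sub_re, Complex.conj_re, inner_self_re]
    ring
  have h5 : (⟪dilation (sech ^ 2) ((-2 : ℝ) • (sech ^ 2 * tanhB)) v, grad v⟫_ℂ).re
      = 2 * ‖a‖ ^ 2 - 2 * (⟪b, a⟫_ℂ).re := by
    rw [dilation_apply, mulOp_smul, inner_add_left, inner_smul_left, inner_smul_left, hab, pow_two,
      inner_mulOp_mul, Complex.conj_ofReal, Complex.add_re, Complex.re_ofReal_mul,
      Complex.conj_ofNat, ← ha]
    have : (2 * ⟪a, a⟫_ℂ).re = 2 * ‖a‖ ^ 2 := by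
      rw [← inner_self_re]; simp
    rw [this]
    ring
  rw [h5, h4, h1]
  ring

theorem integral_abs_mul_exp : ∫ x : ℝ, |x| * Real.exp (-(2 * |x|)) = 1 / 2 := by
  rw [integral_comp_abs (f := fun x => x * Real.exp (-(2 * x)))]
  have h := Real.integral_rpow_mul_exp_neg_mul_Ioi (a := 2) (r := 2) (by norm_num) (by norm_num)
  have h2 : ∫ x in Set.Ioi (0 : ℝ), x * Real.exp (-(2 * x)) = 1 / 4 := by
    rw [Real.Gamma_two] at h
    norm_num at h
    rw [h]
  rw [h2]
  norm_num

theorem integrable_abs_mul_exp : Integrable fun x : ℝ => |x| * Real.exp (-(2 * |x|)) := by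
  by_contra h
  have := integral_undef h
  rw [integral_abs_mul_exp] at this
  norm_num at this

theorem sech_sq_le (x : ℝ) : sech x ^ 2 ≤ 4 * Real.exp (-(2 * |x|)) := by
  have h1 : Real.exp |x| / 2 ≤ Real.cosh x := by
    rw [← Real.cosh_abs, Real.cosh_eq]
    have := Real.exp_pos (-|x|)
    linarith
  have h2 : sech x ≤ 2 * Real.exp (-|x|) := by
    rw [sech_apply, Real.exp_neg, ← div_eq_mul_inv, ← inv_div]
    exact inv_anti₀ (by positivity) h1
  calc sech x ^ 2 ≤ (2 * Real.exp (-|x|)) ^ 2 := by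
        have := sech_pos x
        gcongr
    _ = _ := by
        rw [mul_pow, ← Real.exp_nat_mul]
        norm_num

/-- For odd `w`, the pointwise bound `|w(x)|² ≤ |x|/2 ‖w'‖²` gives `‖sech w‖ ≤ ‖w'‖`, which makes
the virial form coercive. -/
theorem norm_mulOp_sech_le_of_odd (w : H1) (hw : w.IsOdd) :
    ‖mulOp sech (toL2 w)‖ ^ 2 ≤ ‖grad w‖ ^ 2 := by
  rw [norm_sq_eq_integral]
  have h1 : ∫ x, ‖mulOp sech (toL2 w) x‖ ^ 2
      ≤ ∫ x : ℝ, 2 * ‖grad w‖ ^ 2 * (|x| * Real.exp (-(2 * |x|))) := by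
    refine integral_mono_ae (integrable_norm_sq _) (integrable_abs_mul_exp.const_mul _) ?_
    filter_upwards [coeFn_mulOp sech (toL2 w), norm_sq_le_of_odd w hw] with x h1 h2
    rw [h1, norm_mul, mul_pow, Complex.norm_real, Real.norm_eq_abs, sq_abs]
    calc _ ≤ (4 * Real.exp (-(2 * |x|))) * (|x| / 2 * ‖grad w‖ ^ 2) := by
          gcongr
          exact sech_sq_le x
      _ = _ := by ring
  refine h1.trans (le_of_eq ?_)
  rw [integral_const_mul, integral_abs_mul_exp]
  ring

theorem isOdd_conjH1 {v : H1} (hv : v.IsOdd) : (conjH1 v).IsOdd := by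
  have h1 := coeFn_mulOp sech (toL2 v)
  have h2 := (Measure.measurePreserving_neg (volume : Measure ℝ)).quasiMeasurePreserving.ae h1
  unfold H1.IsOdd at hv ⊢
  filter_upwards [h1, h2, hv] with x a b c
  change mulOp sech (toL2 v) (-x) = -(mulOp sech (toL2 v) x)
  have c' : toL2 v (-x) = -toL2 v x := c
  rw [a, b, c', sech_apply, sech_apply, Real.cosh_neg, mul_neg]

theorem norm_sech_sq_le_of_odd {v : H1} (hv : v.IsOdd) :
    ‖mulOp (sech ^ 2) (toL2 v)‖ ^ 2 ≤ ‖grad (conjH1 v)‖ ^ 2 := by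
  have := norm_mulOp_sech_le_of_odd (conjH1 v) (isOdd_conjH1 hv)
  rwa [toL2_conjH1, mulOp_mulOp, ← pow_two] at this

/-! ### Power nonlinearities and the weighted nonlinear estimate -/

theorem norm_rpow_smul_sub_le {r R : ℝ} (hr : 0 < r) {a b : ℂ} (hab : ‖b‖ ≤ ‖a‖) (ha : ‖a‖ ≤ R) :
    ‖((‖a‖ ^ r : ℝ) : ℂ) * a - ((‖b‖ ^ r : ℝ) : ℂ) * b‖ ≤ (⌈r⌉₊ + 1) * R ^ r * ‖a - b‖ := by
  have hR : 0 ≤ R := (norm_nonneg _).trans ha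
  have e : ((‖a‖ ^ r : ℝ) : ℂ) * a - ((‖b‖ ^ r : ℝ) : ℂ) * b
      = ((‖a‖ ^ r : ℝ) : ℂ) * (a - b) + ((‖a‖ ^ r - ‖b‖ ^ r : ℝ) : ℂ) * b := by
    push_cast; ring
  have hAR : ‖a‖ ^ r ≤ R ^ r := Real.rpow_le_rpow (norm_nonneg _) ha hr.le
  have hmono : ‖b‖ ^ r ≤ ‖a‖ ^ r := Real.rpow_le_rpow (norm_nonneg _) hab hr.le
  have key : (‖a‖ ^ r - ‖b‖ ^ r) * ‖b‖ ≤ ⌈r⌉₊ * ‖a‖ ^ r * ‖a - b‖ := by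
    rcases eq_or_ne b 0 with rfl | hb
    · simp; positivity
    have hb0 : 0 < ‖b‖ := norm_pos_iff.2 hb
    have ha0 : 0 < ‖a‖ := hb0.trans_le hab
    -- with `t = ‖b‖ / ‖a‖`, Bernoulli gives `1 - t ^ r ≤ 1 - t ^ n ≤ n (1 - t)` for `n = ⌈r⌉`
    set t := ‖b‖ / ‖a‖ with ht
    have ht0 : 0 < t := by positivity
    have ht1 : t ≤ 1 := (div_le_one ha0).2 hab
    have hbt : ‖b‖ = t * ‖a‖ := by rw [ht]; field_simp
    have h1 : t ^ ⌈r⌉₊ ≤ t ^ r := by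
      rw [← Real.rpow_natCast]
      exact Real.rpow_le_rpow_of_exponent_ge ht0 ht1 (Nat.le_ceil r)
    have h2 : 1 + ⌈r⌉₊ * (t - 1) ≤ t ^ ⌈r⌉₊ := by
      have := one_add_mul_le_pow (a := t - 1) (by linarith) ⌈r⌉₊
      simpa using this
    have h3 : ‖a‖ * (1 - t) ≤ ‖a - b‖ := by
      have := norm_sub_norm_le a b
      rw [hbt] at this
      linarith
    have h4 : ‖b‖ ^ r = t ^ r * ‖a‖ ^ r := by rw [hbt, Real.mul_rpow ht0.le ha0.le]
    have h5 : 1 - t ^ r ≤ ⌈r⌉₊ * (1 - t) := by linarith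
    have h6 : (0 : ℝ) ≤ ⌈r⌉₊ := Nat.cast_nonneg _
    calc (‖a‖ ^ r - ‖b‖ ^ r) * ‖b‖ = ‖a‖ ^ r * (1 - t ^ r) * ‖b‖ := by rw [h4]; ring
      _ ≤ ‖a‖ ^ r * (⌈r⌉₊ * (1 - t)) * ‖a‖ := by gcongr
      _ = ⌈r⌉₊ * ‖a‖ ^ r * (‖a‖ * (1 - t)) := by ring
      _ ≤ _ := by gcongr
  rw [e]
  refine (norm_add_le _ _).trans ?_
  rw [norm_mul, norm_mul, Complex.norm_real, Complex.norm_real,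
    Real.norm_of_nonneg (by positivity), Real.norm_of_nonneg (sub_nonneg.2 hmono)]
  calc _ ≤ ‖a‖ ^ r * ‖a - b‖ + ⌈r⌉₊ * ‖a‖ ^ r * ‖a - b‖ := by gcongr
    _ = (⌈r⌉₊ + 1) * ‖a‖ ^ r * ‖a - b‖ := by ring
    _ ≤ _ := by gcongr

theorem locallyLipschitz_nonlin_rpow {q : ℝ} (hq : 0 < q) :
    LocallyLipschitz (nonlin fun s => s ^ q) := by
  have e : ∀ z : ℂ, nonlin (fun s => s ^ q) z = ((‖z‖ ^ (2 * q) : ℝ) : ℂ) * z := by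
    intro z
    rw [nonlin, Real.rpow_mul (norm_nonneg _)]
    norm_num
  intro x
  refine ⟨Real.toNNReal ((⌈2 * q⌉₊ + 1) * (‖x‖ + 1) ^ (2 * q)), Metric.ball x 1,
    Metric.ball_mem_nhds x one_pos, LipschitzOnWith.of_dist_le_mul fun a ha b hb => ?_⟩
  have hball : ∀ y ∈ Metric.ball x 1, ‖y‖ ≤ ‖x‖ + 1 := by
    intro y hy
    have h1 := norm_sub_norm_le y x
    rw [Metric.mem_ball, dist_eq_norm] at hy
    linarith
  rw [Real.coe_toNNReal _ (by positivity), dist_eq_norm, dist_eq_norm, e, e]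
  rcases le_total ‖b‖ ‖a‖ with hab | hab
  · exact norm_rpow_smul_sub_le (by positivity) hab (hball a ha)
  · rw [norm_sub_rev, norm_sub_rev a]
    exact norm_rpow_smul_sub_le (by positivity) hab (hball b hb)

/-- The power `|z|^(2q + 2)`. -/
def powDensity (q : ℝ) (z : ℂ) : ℝ := (‖z‖ ^ 2) ^ q * ‖z‖ ^ 2

theorem powDensity_nonneg (q : ℝ) (z : ℂ) : 0 ≤ powDensity q z := by
  unfold powDensity; positivity

theorem potential_rpow {q : ℝ} (hq : 0 < q) (z : ℂ) :
    potential (fun s => s ^ q) z = powDensity q z / (2 * (q + 1)) := by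
  rw [potential, integral_rpow (Or.inl (by linarith)), Real.zero_rpow (by linarith), powDensity,
    sub_zero, Real.rpow_add_one' (by positivity) (by linarith), div_div, mul_comm (q + 1)]

theorem inner_nonlin (f : ℝ → ℝ) (z : ℂ) : ⟪z, nonlin f z⟫_ℝ = f (‖z‖ ^ 2) * ‖z‖ ^ 2 := by
  have : nonlin f z = f (‖z‖ ^ 2) • z := Complex.real_smul.symm
  rw [this, real_inner_smul_right, real_inner_self_eq_norm_sq]

theorem abs_potential_le_powDensity {f : ℝ → ℝ} {C q : ℝ} (hq : 0 < q) (hC0 : 0 ≤ C)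
    (hC : ∀ s : ℝ, 0 ≤ s → |f s| ≤ C * s ^ q) (z : ℂ) :
    |potential f z| ≤ C / 2 * powDensity q z := by
  have h := intervalIntegral.norm_integral_le_of_norm_le_const (a := 0) (b := ‖z‖ ^ 2)
    (C := C * (‖z‖ ^ 2) ^ q) (f := f) (fun s hs => by
      rw [Set.uIoc_of_le (by positivity)] at hs
      refine (hC s hs.1.le).trans ?_
      have := Real.rpow_le_rpow hs.1.le hs.2 hq.le
      gcongr)
  rw [sub_zero, abs_of_nonneg (by positivity), Real.norm_eq_abs] at h
  rw [potential, abs_div, abs_two, powDensity]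
  linarith

theorem powDensity_le {q M : ℝ} (hq : 0 < q) {z : ℂ} (hz : ‖z‖ ^ 2 ≤ M) :
    powDensity q z ≤ M ^ q * ‖z‖ ^ 2 := by
  unfold powDensity
  have := Real.rpow_le_rpow (by positivity) hz hq.le
  gcongr

theorem continuousOn_of_growth {f : ℝ → ℝ} {C q : ℝ} (hq : 0 < q)
    (hC : ∀ s : ℝ, 0 ≤ s → |f s| ≤ C * s ^ q) (hL : LocallyLipschitz (nonlin f)) :
    ContinuousOn f (Set.Ici 0) := by
  intro s hs
  rcases eq_or_lt_of_le (show (0 : ℝ) ≤ s from hs) with rfl | hs0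
  · have h0 : f 0 = 0 := by
      have := hC 0 le_rfl
      rw [Real.zero_rpow hq.ne', mul_zero] at this
      exact abs_eq_zero.1 (le_antisymm this (abs_nonneg _))
    rw [ContinuousWithinAt, h0]
    refine squeeze_zero_norm' (a := fun s => C * s ^ q) ?_ ?_
    · filter_upwards [self_mem_nhdsWithin] with y hy using hC y hy
    · have : ContinuousAt (fun s : ℝ => C * s ^ q) 0 :=
        continuousAt_const.mul (Real.continuousAt_rpow_const 0 q (Or.inr hq.le))
      have h2 := this.tendsto
      simp only [Real.zero_rpow hq.ne', mul_zero] at h2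
      exact h2.mono_left nhdsWithin_le_nhds
  · have h1 : ContinuousAt (fun y : ℝ => (nonlin f ((√y : ℝ) : ℂ)).re / √y) s := by
      refine ContinuousAt.div ?_ Real.continuous_sqrt.continuousAt (Real.sqrt_pos.2 hs0).ne'
      exact (Complex.continuous_re.comp (hL.continuous.comp
        (Complex.continuous_ofReal.comp Real.continuous_sqrt))).continuousAt
    refine (h1.congr ?_).continuousWithinAt
    filter_upwards [lt_mem_nhds hs0] with y hy
    have hy' := (Real.sqrt_pos.2 hy).ne'
    rw [nonlin, ← Complex.ofReal_mul, Complex.ofReal_re, Complex.norm_real, Real.norm_eq_abs, sq_abs,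
      Real.sq_sqrt hy.le, mul_div_cancel_right₀ _ hy']

theorem integrable_powDensity {q : ℝ} (hq : 0 < q) (v : H1) :
    Integrable fun x => powDensity q (toL2 v x) := by
  have hf : ContinuousOn (fun s : ℝ => s ^ q) (Set.Ici 0) :=
    (Real.continuous_rpow_const hq.le).continuousOn
  have := (integrable_potential (locallyLipschitz_nonlin_rpow hq) hf v).const_mul (2 * (q + 1))
  refine this.congr (Eventually.of_forall fun x => ?_)
  simp only [potential_rpow hq]
  field_simp

/-- The weighted nonlinear quantity `∫ sech² |v|^(2q+2)`. -/
def weightedPow (q : ℝ) (v : H1) : ℝ := ∫ x, (sech ^ 2 : ℝ →ᵇ ℝ) x * powDensity q (toL2 v x)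

/-- `∫ sech² |v|^(2q+2) ≤ c ‖v‖_∞^(2q) ‖(sech v)'‖²`. Once `sech v'` is written through
`(sech v)'`, the integral of `(tanh sech² |v|^(2q+2))'` contains the positive term
`∫ sech² (sech² + 2q tanh²) |v|^(2q+2)`; the coefficient `2q` of `tanh²` comes from the exponential
decay of the weight. -/
theorem weightedPow_le {q : ℝ} (hq : 0 < q) {M : ℝ} (v : H1)
    (hM : ∀ᵐ x, ‖toL2 v x‖ ^ 2 ≤ M) :
    weightedPow q v ≤ (2 * (q + 1) / min 1 (2 * q)) ^ 2 * M ^ q * ‖grad (conjH1 v)‖ ^ 2 := by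
  set c := min 1 (2 * q) with hc
  have hc0 : 0 < c := lt_min one_pos (by positivity)
  have hM0 : 0 ≤ M := by
    obtain ⟨x, hx⟩ := hM.exists
    exact (by positivity : (0 : ℝ) ≤ ‖toL2 v x‖ ^ 2).trans hx
  have hL := locallyLipschitz_nonlin_rpow hq
  have hf : ContinuousOn (fun s : ℝ => s ^ q) (Set.Ici 0) :=
    (Real.continuous_rpow_const hq.le).continuousOn
  set N := nonlinL2 hL v with hN
  have hP := integrable_powDensity hq v
  -- the chain rule with the multiplier `tanh sech²`
  have h1 := re_inner_mulOp_grad_nonlinL2 hL hf _ _ hasDerivAt_sech_sq_mul_tanhB v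
  have h2 : ⟪mulOp (sech ^ 2 * tanhB) N, grad v⟫_ℂ
      = ⟪mulOp (sech * tanhB) N, grad (conjH1 v)⟫_ℂ
        + ⟪mulOp ((sech * tanhB) * (sech * tanhB)) N, toL2 v⟫_ℂ := by
    rw [grad_conjH1, inner_sub_right, inner_mulOp_mul (sech * tanhB), sub_add_cancel,
      show (sech ^ 2 * tanhB : ℝ →ᵇ ℝ) = sech * (sech * tanhB) by ring, inner_mulOp_mul]
  have h3 : ∀ m : ℝ →ᵇ ℝ, (⟪mulOp m N, toL2 v⟫_ℂ).re = ∫ x, m x * powDensity q (toL2 v x) := by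
    intro m
    rw [re_inner_eq_integral]
    refine integral_congr_ae ?_
    filter_upwards [coeFn_mulOp m N, coeFn_nonlinL2 hL v] with x a b
    have e : ((m x : ℝ) : ℂ) * N x = m x • nonlin (fun s => s ^ q) (toL2 v x) := by
      rw [hN, b]; exact Complex.real_smul.symm
    rw [a, e, real_inner_smul_left, real_inner_comm, inner_nonlin, powDensity]
  have h4 : c * weightedPow q v ≤ 2 * (q + 1) * |(⟪mulOp (sech * tanhB) N, grad (conjH1 v)⟫_ℂ).re| := by
    rw [← hN, h2, Complex.add_re, h3, potentialInt] at h1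
    have h5 : c * weightedPow q v ≤ ∫ x, (2 * (q + 1) * ((((sech * tanhB) * (sech * tanhB) : ℝ →ᵇ ℝ)) x
        * powDensity q (toL2 v x)) + 2 * (q + 1) *
        (((sech ^ 2 * sech ^ 2 - (2 : ℝ) • ((sech * tanhB) * (sech * tanhB)) : ℝ →ᵇ ℝ)) x
          * potential (fun s => s ^ q) (toL2 v x))) := by
      rw [weightedPow, ← integral_const_mul]
      refine integral_mono ((integrable_bcf_mul _ hP).const_mul _)
        (((integrable_bcf_mul _ hP).const_mul _).add
          ((integrable_bcf_mul _ (integrable_potential hL hf v)).const_mul _)) fun x => ?_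
      simp only [potential_rpow hq]
      have hts := tanhB_sq_add_sech_sq x
      have hp := powDensity_nonneg q (toL2 v x)
      set p := powDensity q (toL2 v x)
      have e : 2 * (q + 1) * (((sech * tanhB) * (sech * tanhB) : ℝ →ᵇ ℝ) x * p) + 2 * (q + 1) *
        ((sech ^ 2 * sech ^ 2 - (2 : ℝ) • ((sech * tanhB) * (sech * tanhB)) : ℝ →ᵇ ℝ) x
          * (p / (2 * (q + 1)))) = (2 * q * tanhB x ^ 2 + sech x ^ 2) * (sech x ^ 2 * p) := by
        simp
        field_simp
        ring
      rw [e]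
      have h6 : c ≤ 2 * q * tanhB x ^ 2 + sech x ^ 2 := by
        calc c = c * tanhB x ^ 2 + c * sech x ^ 2 := by rw [← mul_add, hts, mul_one]
          _ ≤ 2 * q * tanhB x ^ 2 + 1 * sech x ^ 2 := by
            gcongr
            · exact min_le_right _ _
            · exact min_le_left _ _
          _ = _ := by ring
      exact mul_le_mul_of_nonneg_right h6 (mul_nonneg (sq_nonneg _) hp)
    rw [integral_add ((integrable_bcf_mul _ hP).const_mul _)
        ((integrable_bcf_mul _ (integrable_potential hL hf v)).const_mul _), integral_const_mul,
        integral_const_mul, ← mul_add] at h5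
    refine h5.trans (mul_le_mul_of_nonneg_left ?_ (by positivity))
    have h7 := neg_abs_le (⟪mulOp (sech * tanhB) N, grad (conjH1 v)⟫_ℂ).re
    linarith
  have h8 : ‖mulOp (sech * tanhB) N‖ ^ 2 ≤ M ^ q * weightedPow q v := by
    rw [norm_sq_eq_integral, weightedPow, ← integral_const_mul]
    refine integral_mono_ae (integrable_norm_sq _) ((integrable_bcf_mul _ hP).const_mul _) ?_
    filter_upwards [coeFn_mulOp (sech * tanhB) N, coeFn_nonlinL2 hL v, hM] with x a b d
    rw [a, hN, b, nonlin, norm_mul, norm_mul, Complex.norm_real, Complex.norm_real, powDensity]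
    have h9 : ((‖toL2 v x‖ ^ 2) ^ q) ≤ M ^ q := Real.rpow_le_rpow (by positivity) d hq.le
    have h10 : tanhB x ^ 2 ≤ 1 := by nlinarith [tanhB_sq_add_sech_sq x, sq_nonneg (sech x)]
    have h11 : 0 ≤ (‖toL2 v x‖ ^ 2) ^ q := by positivity
    rw [Real.norm_of_nonneg h11, mul_pow, mul_pow, Real.norm_eq_abs, sq_abs]
    simp only [BoundedContinuousFunction.coe_mul, BoundedContinuousFunction.coe_pow, Pi.mul_apply,
      Pi.pow_apply]
    calc _ = tanhB x ^ 2 * ((‖toL2 v x‖ ^ 2) ^ q) *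
          (sech x ^ 2 * ((‖toL2 v x‖ ^ 2) ^ q * ‖toL2 v x‖ ^ 2)) := by ring
      _ ≤ 1 * M ^ q * (sech x ^ 2 * ((‖toL2 v x‖ ^ 2) ^ q * ‖toL2 v x‖ ^ 2)) := by gcongr
      _ = _ := by ring
  set X := weightedPow q v with hX
  have hX0 : 0 ≤ X := integral_nonneg fun x => mul_nonneg
    (by simpa using sq_nonneg (sech x)) (powDensity_nonneg _ _)
  have h12 : c * X ≤ 2 * (q + 1) * (‖mulOp (sech * tanhB) N‖ * ‖grad (conjH1 v)‖) := by
    refine h4.trans (mul_le_mul_of_nonneg_left ?_ (by positivity))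
    exact (Complex.abs_re_le_norm _).trans (norm_inner_le_norm _ _)
  rcases hX0.eq_or_lt with h0 | h0
  · rw [← h0]; positivity
  have h13 : (c * X) ^ 2 ≤ (2 * (q + 1)) ^ 2 * (M ^ q * X * ‖grad (conjH1 v)‖ ^ 2) := by
    calc (c * X) ^ 2 ≤ (2 * (q + 1) * (‖mulOp (sech * tanhB) N‖ * ‖grad (conjH1 v)‖)) ^ 2 := by
          gcongr
      _ = (2 * (q + 1)) ^ 2 * (‖mulOp (sech * tanhB) N‖ ^ 2 * ‖grad (conjH1 v)‖ ^ 2) := by ring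
      _ ≤ _ := by gcongr
  have h14 : c ^ 2 * X ≤ (2 * (q + 1)) ^ 2 * (M ^ q * ‖grad (conjH1 v)‖ ^ 2) := by
    refine le_of_mul_le_mul_right ?_ h0
    linarith
  rw [div_pow, mul_assoc, div_mul_eq_mul_div, le_div_iff₀ (by positivity)]
  linarith

/-! ### From the virial estimate to local decay -/

/-- The time derivative of the virial functional with multiplier `tanh`. -/
def virialRate {f : ℝ → ℝ} (hL : LocallyLipschitz (nonlin f)) (v : H1) : ℝ :=
  2 * (⟪dilation (sech ^ 2) ((-2 : ℝ) • (sech ^ 2 * tanhB)) v, grad v⟫_ℂ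
        + ⟪dilation tanhB (sech ^ 2) v, nonlinL2 hL v⟫_ℂ).re

theorem continuous_virialRate {f : ℝ → ℝ} (hL : LocallyLipschitz (nonlin f)) :
    Continuous (virialRate hL) :=
  continuous_const.mul (Complex.continuous_re.comp
    (((dilation _ _).continuous.inner grad.continuous).add
      ((dilation _ _).continuous.inner (continuous_nonlinL2 hL))))

theorem virialRate_eq {f : ℝ → ℝ} (hL : LocallyLipschitz (nonlin f))
    (hf : ContinuousOn f (Set.Ici 0)) (v : H1) :
    virialRate hL v = 2 * (2 * ‖grad (conjH1 v)‖ ^ 2 - ‖mulOp (sech ^ 2) (toL2 v)‖ ^ 2)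
      + 2 * ((⟪mulOp (sech ^ 2) (toL2 v), nonlinL2 hL v⟫_ℂ).re
        - 2 * potentialInt f (sech ^ 2) v) := by
  have h1 := re_inner_mulOp_grad_nonlinL2 hL hf tanhB (sech ^ 2) hasDerivAt_tanhB v
  have h2 : (⟪dilation tanhB (sech ^ 2) v, nonlinL2 hL v⟫_ℂ).re
      = (⟪mulOp (sech ^ 2) (toL2 v), nonlinL2 hL v⟫_ℂ).re - 2 * potentialInt f (sech ^ 2) v := by
    rw [dilation_apply, inner_add_left, inner_smul_left, Complex.conj_ofNat, Complex.add_re,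
      inner_mulOp_left, ← inner_conj_symm (grad v)]
    have : ∀ z : ℂ, (2 * (starRingEnd ℂ) z).re = 2 * z.re := fun z => by simp
    rw [this, h1]
    ring
  rw [virialRate, Complex.add_re, re_inner_dilation_eq, h2]
  ring

theorem eLpNorm_eq_norm (v : L2) : eLpNorm v 2 volume = ENNReal.ofReal ‖v‖ := by
  rw [Lp.norm_def, ENNReal.ofReal_toReal (Lp.eLpNorm_ne_top v)]

theorem norm_mulH1_sech_sq_le (v : H1) :
    ‖grad (mulH1 _ _ contDiff_sech_sq hasDerivAt_sech_sq v)‖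
      ≤ ‖mulH1 _ _ contDiff_sech_sq hasDerivAt_sech_sq‖ * ‖v‖ :=
  (norm_grad_le _).trans (ContinuousLinearMap.le_opNorm _ _)

/-- For a bounded family in `H¹`, decay of `sech² u(t)` in `L²` implies local decay, by the
Sobolev inequality for `sech² u(t)`. -/
theorem localDecay_of_tendsto {u : ℝ → H1} {B : ℝ} (hB : ∀ t, ‖u t‖ ≤ B)
    (h : Tendsto (fun t => ‖mulOp (sech ^ 2) (toL2 (u t))‖) atTop (𝓝 0)) : LocalDecay u := by
  intro I hI hIb
  set A : H1 →L[ℂ] H1 := mulH1 _ _ contDiff_sech_sq hasDerivAt_sech_sq with hA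
  set z : ℝ → L2 := fun t => mulOp (sech ^ 2) (toL2 (u t)) with hz
  set D : ℝ := ‖A‖ * B with hD
  obtain ⟨ρ, hρ⟩ := hIb.subset_closedBall 0
  -- the weight is bounded below on the interval
  set κ : ℝ := sech ρ ^ 2 with hκ
  have hκ0 : 0 < κ := pow_pos (sech_pos ρ) 2
  have hκI : ∀ x ∈ I, κ ≤ sech x ^ 2 := by
    intro x hx
    have h1 : |x| ≤ ρ := by simpa using hρ hx
    have h2 : Real.cosh x ≤ Real.cosh ρ := Real.cosh_le_cosh.2 (h1.trans (le_abs_self ρ))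
    have h3 : sech ρ ≤ sech x := inv_anti₀ (Real.cosh_pos x) h2
    have := sech_pos ρ
    rw [hκ]
    gcongr
  have hpt : ∀ t, ∀ᵐ x ∂(volume.restrict I), ‖(u t).fn x‖ ≤ κ⁻¹ * ‖z t x‖ := by
    intro t
    rw [ae_restrict_iff' hI.measurableSet]
    filter_upwards [coeFn_mulOp (sech ^ 2) (toL2 (u t))] with x h1 hx
    rw [hz, h1, norm_mul, Complex.norm_real, le_inv_mul_iff₀ hκ0]
    simp only [BoundedContinuousFunction.coe_pow, Pi.pow_apply]
    rw [Real.norm_of_nonneg (sq_nonneg _)]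
    exact mul_le_mul_of_nonneg_right (hκI x hx) (norm_nonneg _)
  have h2 : ∀ t, eLpNorm (u t).fn 2 (volume.restrict I) ≤ ENNReal.ofReal (κ⁻¹ * ‖z t‖) := by
    intro t
    refine (eLpNorm_le_mul_eLpNorm_of_ae_le_mul (hpt t) 2).trans ?_
    rw [ENNReal.ofReal_mul (by positivity), ← eLpNorm_eq_norm]
    gcongr
    exact Measure.restrict_le_self
  have h3 : ∀ t, eLpNorm (u t).fn ⊤ (volume.restrict I)
      ≤ ENNReal.ofReal (κ⁻¹ * √(2 * (‖z t‖ * D))) := by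
    intro t
    rw [eLpNorm_exponent_top]
    refine eLpNormEssSup_le_of_ae_bound ?_
    filter_upwards [hpt t, ae_restrict_of_ae (norm_sq_le_of_H1 (A (u t)))] with x a b
    refine a.trans (mul_le_mul_of_nonneg_left (Real.le_sqrt_of_sq_le ?_) (by positivity))
    have h4 : ‖grad (A (u t))‖ ≤ D := by
      refine (norm_mulH1_sech_sq_le (u t)).trans ?_
      exact mul_le_mul_of_nonneg_left (hB t) (ContinuousLinearMap.opNorm_nonneg _)
    refine b.trans ?_
    change 2 * (‖z t‖ * ‖grad (A (u t))‖) ≤ _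
    gcongr
  have hz0 : Tendsto (fun t => ‖z t‖) atTop (𝓝 0) := h
  have l1 : Tendsto (fun t => ENNReal.ofReal (κ⁻¹ * ‖z t‖)) atTop (𝓝 0) := by
    have := ENNReal.tendsto_ofReal (hz0.const_mul κ⁻¹)
    simpa using this
  have l2 : Tendsto (fun t => ENNReal.ofReal (κ⁻¹ * √(2 * (‖z t‖ * D)))) atTop (𝓝 0) := by
    have h5 : Tendsto (fun t => 2 * (‖z t‖ * D)) atTop (𝓝 0) := by
      simpa using (hz0.mul_const D).const_mul 2
    have h6 := (Real.continuous_sqrt.tendsto 0).comp h5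
    rw [Real.sqrt_zero] at h6
    simpa using ENNReal.tendsto_ofReal (h6.const_mul κ⁻¹)
  have l3 := l1.add l2
  rw [add_zero] at l3
  exact tendsto_of_tendsto_of_tendsto_of_le_of_le tendsto_const_nhds l3 (fun _ => zero_le)
    fun t => add_le_add (h2 t) (h3 t)

/-- If the virial rate dominates `‖sech² u‖²` along a solution that is bounded in `H¹`, then this
quantity is integrable in time. Its derivative is bounded, so it tends to zero. -/
theorem IsGlobalSolution.localDecay {f : ℝ → ℝ} (hL : LocallyLipschitz (nonlin f)) {u : ℝ → H1}
    (hu : IsGlobalSolution f u) {B : ℝ} (hB : ∀ t, ‖u t‖ ≤ B)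
    (hR : ∀ t, ‖mulOp (sech ^ 2) (toL2 (u t))‖ ^ 2 ≤ virialRate hL (u t)) : LocalDecay u := by
  have hB0 : 0 ≤ B := (norm_nonneg _).trans (hB 0)
  set y : ℝ → ℝ := fun t => ‖mulOp (sech ^ 2) (toL2 (u t))‖ ^ 2 with hy
  have hy0 : ∀ t, 0 ≤ y t := fun t => sq_nonneg _
  have huc := hu.continuous
  have hyc : Continuous y :=
    ((mulOp _).continuous.comp (toL2.continuous.comp huc)).norm.pow 2
  -- integrability of `y` from the virial identity
  set Dl := dilation tanhB (sech ^ 2) with hDl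
  have hQ : ∀ t, |(⟪Dl (u t), toL2 (u t)⟫_ℂ).im| ≤ ‖Dl‖ * B * B := by
    intro t
    refine (Complex.abs_im_le_norm _).trans ((norm_inner_le_norm _ _).trans ?_)
    have h1 := (Dl.le_opNorm (u t)).trans
      (mul_le_mul_of_nonneg_left (hB t) (ContinuousLinearMap.opNorm_nonneg _))
    exact mul_le_mul h1 ((norm_toL2_le _).trans (hB t)) (norm_nonneg _) (by positivity)
  have hint : ∀ t, 0 ≤ t → ∫ s in (0 : ℝ)..t, ‖y s‖ ≤ 2 * (‖Dl‖ * B * B) := by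
    intro t ht
    have h1 : ∫ s in (0 : ℝ)..t, ‖y s‖ ≤ ∫ s in (0 : ℝ)..t, virialRate hL (u s) := by
      refine intervalIntegral.integral_mono_on ht (hyc.norm.intervalIntegrable _ _)
        (((continuous_virialRate hL).comp huc).intervalIntegrable _ _) fun s _ => ?_
      rw [Real.norm_of_nonneg (hy0 s)]
      exact hR s
    have h2 := hu.virial hL contDiff_tanhB contDiff_sech_sq hasDerivAt_tanhB hasDerivAt_sech_sq t
    have h3 : ∫ s in (0 : ℝ)..t, virialRate hL (u s)
      = -(⟪Dl (u t), toL2 (u t)⟫_ℂ).im + (⟪Dl (u 0), toL2 (u 0)⟫_ℂ).im := h2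
    have h4 := neg_abs_le (⟪Dl (u t), toL2 (u t)⟫_ℂ).im
    have h5 := le_abs_self (⟪Dl (u 0), toL2 (u 0)⟫_ℂ).im
    linarith [hQ t, hQ 0]
  have hyi : IntegrableOn y (Set.Ioi 0) :=
    integrableOn_Ioi_of_intervalIntegral_norm_bounded (l := atTop) (b := id)
      (2 * (‖Dl‖ * B * B)) 0 (fun t => (hyc.integrableOn_Icc (a := 0) (b := t)).mono_set
        Set.Ioc_subset_Icc_self) tendsto_id
      ((eventually_ge_atTop 0).mono fun t ht => hint t ht)
  -- the derivative of `y` is bounded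
  obtain ⟨K, hK0, hK⟩ := exists_lipschitz_nonlinL2 hL B
  have hN : ∀ t, ‖nonlinL2 hL (u t)‖ ≤ K * B := by
    intro t
    have h1 := hK (u t) 0 (hB t) (by simpa using hB0)
    have h2 : nonlinL2 hL 0 = 0 := by
      rw [Lp.eq_zero_iff_ae_eq_zero]
      filter_upwards [coeFn_nonlinL2 hL 0, Lp.coeFn_zero ℂ 2 (volume : Measure ℝ)] with x a b
      rw [a, map_zero, b]
      exact nonlin_zero f
    rw [h2, sub_zero, map_zero, sub_zero] at h1
    exact h1.trans (mul_le_mul_of_nonneg_left ((norm_toL2_le _).trans (hB t)) hK0)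
  set A : H1 →L[ℂ] H1 := mulH1 _ _ contDiff_sech_sq hasDerivAt_sech_sq with hA
  set y' : ℝ → ℝ := fun t => 2 * (⟪grad ((A.comp A) (u t)), grad (u t)⟫_ℂ
    + ⟪((mulOp (sech ^ 2)).comp (mulOp (sech ^ 2))) (toL2 (u t)), nonlinL2 hL (u t)⟫_ℂ).im with hy'
  have hd : ∀ t, HasDerivAt y (y' t) t := by
    intro t
    have h1 := hu.hasDerivAt_form hL (L := (mulOp (sech ^ 2)).comp (mulOp (sech ^ 2)))
      (LH := A.comp A) (fun v => rfl) (fun v w => by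
        change ⟪mulOp (sech ^ 2) (mulOp (sech ^ 2) v), w⟫_ℂ
          = ⟪v, mulOp (sech ^ 2) (mulOp (sech ^ 2) w)⟫_ℂ
        rw [inner_mulOp_left, inner_mulOp_left]) t
    refine h1.congr_of_eventuallyEq (Eventually.of_forall fun s => ?_)
    change y s = (⟪mulOp (sech ^ 2) (mulOp (sech ^ 2) (toL2 (u s))), toL2 (u s)⟫_ℂ).re
    rw [inner_mulOp_left, inner_self_re]
  set E : ℝ := 2 * (‖A.comp A‖ * B * B
    + ‖(mulOp (sech ^ 2)).comp (mulOp (sech ^ 2))‖ * B * (K * B)) with hE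
  have hy'b : ∀ t, |y' t| ≤ E := by
    intro t
    rw [hy', abs_mul, abs_two, hE]
    refine mul_le_mul_of_nonneg_left ?_ (by norm_num)
    refine (Complex.abs_im_le_norm _).trans ((norm_add_le _ _).trans (add_le_add ?_ ?_))
    · refine (norm_inner_le_norm _ _).trans (mul_le_mul ?_ ((norm_grad_le _).trans (hB t))
        (norm_nonneg _) (by positivity))
      exact (norm_grad_le _).trans ((ContinuousLinearMap.le_opNorm _ _).trans
        (mul_le_mul_of_nonneg_left (hB t) (ContinuousLinearMap.opNorm_nonneg _)))
    · refine (norm_inner_le_norm _ _).trans (mul_le_mul ?_ (hN t)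
        (norm_nonneg _) (by positivity))
      exact (ContinuousLinearMap.le_opNorm _ _).trans
        (mul_le_mul_of_nonneg_left ((norm_toL2_le _).trans (hB t)) (norm_nonneg _))
  have hym : Measurable y' := by
    have : y' = deriv y := by
      funext t
      exact (hd t).deriv.symm
    rw [this]
    exact measurable_deriv y
  -- `y ^ 2` and its derivative `2 y y'` are integrable because `y` is
  have hyB : ∀ t, y t ≤ (‖(sech ^ 2 : ℝ →ᵇ ℝ)‖ * B) ^ 2 := by
    intro t
    have h1 := (norm_mulOp_le (sech ^ 2) (toL2 (u t))).trans
      (mul_le_mul_of_nonneg_left ((norm_toL2_le _).trans (hB t)) (norm_nonneg _))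
    simp only [hy]
    gcongr
  have hi1 : IntegrableOn (fun t => y t ^ 2) (Set.Ioi 0) := by
    refine (hyi.const_mul ((‖(sech ^ 2 : ℝ →ᵇ ℝ)‖ * B) ^ 2)).mono'
      (hyc.pow 2).aestronglyMeasurable (Eventually.of_forall fun t => ?_)
    rw [Real.norm_of_nonneg (sq_nonneg _), pow_two]
    exact mul_le_mul_of_nonneg_right (hyB t) (hy0 t)
  have hi2 : IntegrableOn (fun t => 2 * y t * y' t) (Set.Ioi 0) := by
    refine (hyi.const_mul (2 * E)).mono'
      ((continuous_const.mul hyc).measurable.mul hym).aestronglyMeasurable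
      (Eventually.of_forall fun t => ?_)
    rw [norm_mul, norm_mul, Real.norm_of_nonneg (hy0 t), Real.norm_eq_abs (y' t), Real.norm_two]
    have := mul_le_mul_of_nonneg_left (hy'b t) (hy0 t)
    linarith
  have hlim := tendsto_zero_of_hasDerivAt_of_integrableOn_Ioi (a := 0)
    (fun t _ => ((hd t).pow 2).congr_deriv (show _ = 2 * y t * y' t by norm_num)) hi2 hi1
  refine localDecay_of_tendsto hB ?_
  have h4 := (Real.continuous_sqrt.tendsto 0).comp
    ((Real.continuous_sqrt.tendsto 0).comp hlim |>.trans (by rw [Real.sqrt_zero]))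
  rw [Real.sqrt_zero] at h4
  refine h4.congr fun t => ?_
  change √(√(y t ^ 2)) = _
  rw [Real.sqrt_sq (hy0 t), Real.sqrt_sq (norm_nonneg _)]

/-! ### Small solutions and the defocusing case -/

theorem re_inner_sech_sq_nonlin {f : ℝ → ℝ} (hL : LocallyLipschitz (nonlin f)) (v : H1) :
    (⟪mulOp (sech ^ 2) (toL2 v), nonlinL2 hL v⟫_ℂ).re
      = ∫ x, (sech ^ 2 : ℝ →ᵇ ℝ) x * (f (‖toL2 v x‖ ^ 2) * ‖toL2 v x‖ ^ 2) := by
  rw [re_inner_eq_integral]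
  refine integral_congr_ae ?_
  filter_upwards [coeFn_mulOp (sech ^ 2) (toL2 v), coeFn_nonlinL2 hL v] with x a b
  have e : (((sech ^ 2 : ℝ →ᵇ ℝ) x : ℝ) : ℂ) * toL2 v x = (sech ^ 2 : ℝ →ᵇ ℝ) x • toL2 v x :=
    Complex.real_smul.symm
  rw [a, b, e, real_inner_smul_left, inner_nonlin]

theorem integrable_nonlin_density {f : ℝ → ℝ} (hL : LocallyLipschitz (nonlin f)) (v : H1) :
    Integrable fun x => f (‖toL2 v x‖ ^ 2) * ‖toL2 v x‖ ^ 2 := by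
  refine (integrable_real_inner (toL2 v) (nonlinL2 hL v)).congr ?_
  filter_upwards [coeFn_nonlinL2 hL v] with x b
  rw [b, inner_nonlin]

theorem sech_sq_apply_nonneg (x : ℝ) : 0 ≤ (sech ^ 2 : ℝ →ᵇ ℝ) x := by
  simpa using sq_nonneg (sech x)

/-- The nonlinear part of the virial rate is at least `-4C ∫ sech² |v|^(2q+2)`. -/
theorem virialRate_ge {f : ℝ → ℝ} {C q : ℝ} (hq : 0 < q) (hC0 : 0 ≤ C)
    (hC : ∀ s : ℝ, 0 ≤ s → |f s| ≤ C * s ^ q) (hL : LocallyLipschitz (nonlin f)) {v : H1}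
    (hv : v.IsOdd) : 2 * ‖grad (conjH1 v)‖ ^ 2 - 4 * C * weightedPow q v ≤ virialRate hL v := by
  have hf := continuousOn_of_growth hq hC hL
  have hP := integrable_powDensity hq v
  have h1 : -(C * weightedPow q v) ≤ (⟪mulOp (sech ^ 2) (toL2 v), nonlinL2 hL v⟫_ℂ).re := by
    rw [re_inner_sech_sq_nonlin, weightedPow, ← integral_const_mul, ← integral_neg]
    refine integral_mono ((integrable_bcf_mul _ hP).const_mul _).neg
      (integrable_bcf_mul _ (integrable_nonlin_density hL v)) fun x => ?_
    have h2 := (neg_le_abs _).trans (hC (‖toL2 v x‖ ^ 2) (by positivity))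
    have h3 : -(f (‖toL2 v x‖ ^ 2) * ‖toL2 v x‖ ^ 2) ≤ C * powDensity q (toL2 v x) := by
      rw [powDensity, ← mul_assoc, ← neg_mul]
      gcongr
    have h4 := mul_le_mul_of_nonneg_left h3 (sech_sq_apply_nonneg x)
    simp only at h4 ⊢
    linarith
  have h2 : potentialInt f (sech ^ 2) v ≤ C / 2 * weightedPow q v := by
    rw [potentialInt, weightedPow, ← integral_const_mul]
    refine integral_mono (integrable_bcf_mul _ (integrable_potential hL hf v))
      ((integrable_bcf_mul _ hP).const_mul _) fun x => ?_
    have h3 := (le_abs_self _).trans (abs_potential_le_powDensity hq hC0 hC (toL2 v x))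
    have h4 := mul_le_mul_of_nonneg_left h3 (sech_sq_apply_nonneg x)
    simp only at h4 ⊢
    linarith
  rw [virialRate_eq hL hf]
  have := norm_sech_sq_le_of_odd hv
  linarith

theorem IsGlobalSolution.localDecay_of_small {f : ℝ → ℝ} {C q : ℝ} (hq : 0 < q) (hC0 : 0 ≤ C)
    (hC : ∀ s : ℝ, 0 ≤ s → |f s| ≤ C * s ^ q) (hL : LocallyLipschitz (nonlin f)) {u : ℝ → H1}
    (hu : IsGlobalSolution f u) (hodd : ∀ t, (u t).IsOdd) {B M : ℝ} (hB : ∀ t, ‖u t‖ ≤ B)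
    (hM : ∀ t, ∀ᵐ x, ‖toL2 (u t) x‖ ^ 2 ≤ M)
    (hsmall : 4 * C * ((2 * (q + 1) / min 1 (2 * q)) ^ 2 * M ^ q) ≤ 1) : LocalDecay u := by
  refine hu.localDecay hL hB fun t => ?_
  have h1 := virialRate_ge hq hC0 hC hL (hodd t)
  have h2 := weightedPow_le hq (u t) (hM t)
  have h3 := norm_sech_sq_le_of_odd (hodd t)
  have h4 : 4 * C * weightedPow q (u t) ≤ 1 * ‖grad (conjH1 (u t))‖ ^ 2 := by
    calc _ ≤ 4 * C * ((2 * (q + 1) / min 1 (2 * q)) ^ 2 * M ^ q * ‖grad (conjH1 (u t))‖ ^ 2) := by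
          gcongr
      _ = 4 * C * ((2 * (q + 1) / min 1 (2 * q)) ^ 2 * M ^ q) * ‖grad (conjH1 (u t))‖ ^ 2 := by ring
      _ ≤ _ := by gcongr
  linarith

theorem abs_potentialInt_one_le {f : ℝ → ℝ} {C q : ℝ} (hq : 0 < q) (hC0 : 0 ≤ C)
    (hC : ∀ s : ℝ, 0 ≤ s → |f s| ≤ C * s ^ q) (v : H1) :
    |potentialInt f 1 v| ≤ C / 2 * ((2 * (‖toL2 v‖ * ‖grad v‖)) ^ q * ‖toL2 v‖ ^ 2) := by
  rw [potentialInt, norm_sq_eq_integral, ← integral_const_mul, ← integral_const_mul,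
    ← Real.norm_eq_abs]
  refine norm_integral_le_of_norm_le (((integrable_norm_sq _).const_mul _).const_mul _) ?_
  filter_upwards [norm_sq_le_of_H1 v] with x hx
  have h1 := abs_potential_le_powDensity hq hC0 hC (toL2 v x)
  have h2 := powDensity_le hq hx
  have h3 : ‖((1 : ℝ →ᵇ ℝ) x) * potential f (toL2 v x)‖ = |potential f (toL2 v x)| := by simp
  rw [h3]
  refine h1.trans ?_
  gcongr

/-- A priori bound for small data: conservation of mass and energy with `q < 2`. -/
theorem IsGlobalSolution.norm_grad_le_of_small {f : ℝ → ℝ} {C q ε : ℝ} (hq : 0 < q) (hq2 : q < 2)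
    (hC0 : 0 ≤ C) (hC : ∀ s : ℝ, 0 ≤ s → |f s| ≤ C * s ^ q) (hL : LocallyLipschitz (nonlin f))
    {u : ℝ → H1} (hu : IsGlobalSolution f u) (hε1 : ε ≤ 1) (hε2 : 8 * C * ε ^ 2 ≤ 1)
    (h0 : ‖u 0‖ ≤ ε) (t : ℝ) : ‖grad (u t)‖ ^ 2 ≤ (2 + 12 * C) * ε ^ 2 := by
  have hε0 : 0 ≤ ε := (norm_nonneg _).trans h0
  have hf := continuousOn_of_growth hq hC hL
  have hm : ∀ t, ‖toL2 (u t)‖ ≤ ε := fun t => by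
    rw [hu.mass_eq hL t]
    exact (norm_toL2_le _).trans h0
  have hpow : ∀ X : ℝ, 0 ≤ X → X ^ q ≤ 1 + X ^ 2 := by
    intro X hX
    rcases le_total X 1 with h | h
    · have := Real.rpow_le_one hX h hq.le
      nlinarith [sq_nonneg X]
    · have := Real.rpow_le_rpow_of_exponent_le h hq2.le
      rw [Real.rpow_two] at this
      linarith
  have hpot : ∀ t, |potentialInt f 1 (u t)| ≤ C / 2 * ((1 + 4 * ‖grad (u t)‖ ^ 2) * ε ^ 2) := by
    intro t
    refine (abs_potentialInt_one_le hq hC0 hC (u t)).trans ?_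
    have h1 : (2 * (‖toL2 (u t)‖ * ‖grad (u t)‖)) ^ q ≤ 1 + 4 * ‖grad (u t)‖ ^ 2 := by
      have h2 : 2 * (‖toL2 (u t)‖ * ‖grad (u t)‖) ≤ 2 * ‖grad (u t)‖ := by
        have := mul_le_mul_of_nonneg_right ((hm t).trans hε1) (norm_nonneg (grad (u t)))
        linarith
      refine (Real.rpow_le_rpow (by positivity) h2 hq.le).trans ?_
      have := hpow (2 * ‖grad (u t)‖) (by positivity)
      linarith
    have := hm t
    gcongr
  have hE := hu.energy_eq hL hf t
  unfold energy at hE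
  have h1 := hpot t
  have h2 := hpot 0
  have h3 : ‖grad (u 0)‖ ^ 2 ≤ ε ^ 2 := by
    have := (norm_grad_le (u 0)).trans h0
    gcongr
  have h4 : ε ^ 2 ≤ 1 := by nlinarith
  have h5 : C / 2 * ((1 + 4 * ‖grad (u 0)‖ ^ 2) * ε ^ 2) ≤ C / 2 * ((1 + 4 * 1) * ε ^ 2) := by
    have := h3.trans h4
    gcongr
  have h6 : C / 2 * ((1 + 4 * ‖grad (u t)‖ ^ 2) * ε ^ 2)
      ≤ C / 2 * ε ^ 2 + ‖grad (u t)‖ ^ 2 / 4 := by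
    have := mul_le_mul_of_nonneg_right hε2 (sq_nonneg ‖grad (u t)‖)
    linarith
  have h7 := neg_abs_le (potentialInt f 1 (u t))
  have h8 := le_abs_self (potentialInt f 1 (u 0))
  linarith

theorem exists_small_localDecay {f : ℝ → ℝ} {C q : ℝ} (hq : 0 < q) (hq2 : q < 2)
    (hC0 : 0 ≤ C) (hC : ∀ s : ℝ, 0 ≤ s → |f s| ≤ C * s ^ q) (hL : LocallyLipschitz (nonlin f)) :
    ∃ ε : ℝ, 0 < ε ∧ ∀ u : ℝ → H1, IsGlobalSolution f u → (∀ t : ℝ, (u t).IsOdd) → ‖u 0‖ ≤ ε →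
      LocalDecay u := by
  set k : ℝ := (2 * (q + 1) / min 1 (2 * q)) ^ 2 with hk
  -- `ε` is small enough for the a priori bound and for `‖u‖_∞² ≤ M(ε)` to absorb the nonlinearity
  set M : ℝ → ℝ := fun ε => 2 * (ε * √((2 + 12 * C) * ε ^ 2)) with hMdef
  have hMc : Continuous M := by fun_prop
  have e1 : ∀ᶠ ε in 𝓝[>] (0 : ℝ), 4 * C * (k * M ε ^ q) ≤ 1 := by
    have h1 : Tendsto (fun ε => 4 * C * (k * M ε ^ q)) (𝓝 0) (𝓝 0) := by
      have h2 : Continuous fun ε => 4 * C * (k * M ε ^ q) :=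
        continuous_const.mul (continuous_const.mul
          ((Real.continuous_rpow_const hq.le).comp hMc))
      have h3 := h2.tendsto 0
      have h4 : M 0 = 0 := by simp [hMdef]
      simpa [h4, Real.zero_rpow hq.ne'] using h3
    filter_upwards [(h1.mono_left nhdsWithin_le_nhds).eventually_lt_const one_pos] with ε hε
      using hε.le
  have e2 : ∀ᶠ ε in 𝓝[>] (0 : ℝ), 8 * C * ε ^ 2 ≤ 1 := by
    have h1 : Tendsto (fun ε : ℝ => 8 * C * ε ^ 2) (𝓝 0) (𝓝 0) := by
      have h2 : Continuous fun ε : ℝ => 8 * C * ε ^ 2 := by fun_prop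
      simpa using h2.tendsto 0
    filter_upwards [(h1.mono_left nhdsWithin_le_nhds).eventually_lt_const one_pos] with ε hε
      using hε.le
  have e3 : ∀ᶠ ε in 𝓝[>] (0 : ℝ), ε ≤ 1 := by
    filter_upwards [(tendsto_id.mono_left nhdsWithin_le_nhds :
      Tendsto id (𝓝[>] (0 : ℝ)) (𝓝 0)).eventually_lt_const one_pos] with ε hε using le_of_lt hε
  obtain ⟨ε, h1, h2, h3, h4⟩ := (e1.and (e2.and (e3.and self_mem_nhdsWithin))).exists
  have hε0 : (0 : ℝ) < ε := h4
  refine ⟨ε, hε0, fun u hu hodd h0 => ?_⟩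
  have hg := hu.norm_grad_le_of_small hq hq2 hC0 hC hL h3 h2 h0
  have hg' : ∀ t, ‖grad (u t)‖ ≤ √((2 + 12 * C) * ε ^ 2) := fun t =>
    Real.le_sqrt_of_sq_le (hg t)
  have hm : ∀ t, ‖toL2 (u t)‖ ≤ ε := fun t => by
    rw [hu.mass_eq hL t]
    exact (norm_toL2_le _).trans h0
  refine hu.localDecay_of_small hq hC0 hC hL hodd
    (B := √(ε ^ 2 + (2 + 12 * C) * ε ^ 2)) (M := M ε) (fun t => ?_) (fun t => ?_) h1
  · refine Real.le_sqrt_of_sq_le ?_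
    rw [norm_sq_H1]
    have := hm t
    exact add_le_add (by gcongr) (hg t)
  · filter_upwards [norm_sq_le_of_H1 (u t)] with x hx
    refine hx.trans ?_
    rw [hMdef]
    have := mul_le_mul (hm t) (hg' t) (norm_nonneg _) hε0.le
    linarith

theorem localDecay_of_defocusing {q : ℝ} (hq : 0 < q) {u : ℝ → H1}
    (hu : IsGlobalSolution (fun s => s ^ q) u) (hodd : ∀ t, (u t).IsOdd) : LocalDecay u := by
  have hL := locallyLipschitz_nonlin_rpow hq
  have hf : ContinuousOn (fun s : ℝ => s ^ q) (Set.Ici 0) :=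
    (Real.continuous_rpow_const hq.le).continuousOn
  have hpot0 : ∀ z : ℂ, 0 ≤ potential (fun s => s ^ q) z := fun z => by
    rw [potential_rpow hq]
    exact div_nonneg (powDensity_nonneg q z) (by positivity)
  have hP0 : ∀ v : H1, 0 ≤ potentialInt (fun s => s ^ q) 1 v := fun v =>
    integral_nonneg fun x => mul_nonneg (by simp) (hpot0 _)
  have hg : ∀ t, ‖grad (u t)‖ ^ 2 ≤ 2 * energy (fun s => s ^ q) (u 0) := by
    intro t
    rw [← hu.energy_eq hL hf t, energy]
    linarith [hP0 (u t)]
  refine hu.localDecay hL (B := √(‖toL2 (u 0)‖ ^ 2 + 2 * energy (fun s => s ^ q) (u 0)))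
    (fun t => ?_) fun t => ?_
  · refine Real.le_sqrt_of_sq_le ?_
    rw [norm_sq_H1, hu.mass_eq hL t]
    linarith [hg t]
  · have h1 := norm_sech_sq_le_of_odd (hodd t)
    have h2 : 2 * potentialInt (fun s => s ^ q) (sech ^ 2) (u t)
        ≤ (⟪mulOp (sech ^ 2) (toL2 (u t)), nonlinL2 hL (u t)⟫_ℂ).re := by
      rw [re_inner_sech_sq_nonlin, potentialInt, ← integral_const_mul]
      refine integral_mono
        ((integrable_bcf_mul _ (integrable_potential hL hf (u t))).const_mul _)
        (integrable_bcf_mul _ (integrable_nonlin_density hL (u t))) fun x => ?_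
      have h3 : 2 * potential (fun s => s ^ q) (toL2 (u t) x) ≤ powDensity q (toL2 (u t) x) := by
        rw [potential_rpow hq, mul_div_assoc', div_le_iff₀ (by positivity)]
        nlinarith [powDensity_nonneg q (toL2 (u t) x)]
      have h4 := mul_le_mul_of_nonneg_left h3 (sech_sq_apply_nonneg x)
      rw [powDensity] at h4
      simp only at h4 ⊢
      linarith
    rw [virialRate_eq hL hf]
    linarith [sq_nonneg ‖grad (conjH1 (u t))‖]

end OddNLS

end

theorem theorem1p1 (p : ℝ) (hp1 : 1 < p) (hp5 : p < 5) :
    (∀ f : ℝ → ℝ,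
      (∃ C : ℝ, ∀ s : ℝ, 0 ≤ s → |f s| ≤ C * s ^ ((p - 1) / 2)) →
      LocallyLipschitz (OddNLS.nonlin f) →
      ∃ ε : ℝ, 0 < ε ∧ ∀ u : ℝ → OddNLS.H1,
        OddNLS.IsGlobalSolution f u → (∀ t : ℝ, (u t).IsOdd) → ‖u 0‖ ≤ ε →
          OddNLS.LocalDecay u) ∧
    (∀ u : ℝ → OddNLS.H1,
      OddNLS.IsGlobalSolution (fun s => s ^ ((p - 1) / 2)) u → (∀ t : ℝ, (u t).IsOdd) →
        OddNLS.LocalDecay u) := by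
  refine ⟨fun f ⟨C, hC⟩ hL => ?_, fun u hu hodd =>
    OddNLS.localDecay_of_defocusing (by linarith) hu hodd⟩
  have hC0 : 0 ≤ C := by
    have := (abs_nonneg _).trans (hC 1 zero_le_one)
    rwa [Real.one_rpow, mul_one] at this
  exact OddNLS.exists_small_localDecay (by linarith) (by linarith) hC0 hC hL
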